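/- **Setting.** Let $\mathcal M=(S,\mathbf P,\mu,Ap,L)$ be a finite-state Markov chain with transition matrix $\mathbf P$, initial distribution $\mu$ and labelling $L:S\to 2^{Ap}$ ($Ap$ finite). Let $\varphi$ be an LTL formula over $Ap$ with $p_\varphi:=\mathbb P[\mathcal M\models\varphi]=\mathbb P[\{\rho\mid L(\rho)\models\varphi\}]>0$, and let $\mathcal A=(Q,2^{Ap},\gamma,q_0,Acc)$, $Acc\subseteq 2^Q\times 2^Q$, be any deterministic Rabin automaton (with $Q$ finite) that accepts exactly the words satisfying $\varphi$; a word is accepted if for some $(E,F)\in Acc$ the run of $\mathcal A$ on it visits $E$ finitely often and $F$ infinitely often. The product chain $\mathcal M\otimes\mathcal A$ on $S\times Q$ moves from $(s,q)$ to $(s',\gamma(q,L(s')))$ with probability $\mathbf P(s,s')$ and starts in $(s,\gamma(q_0,L(s)))$ with probability $\mu(s)$. For a finite path $\pi$ of $\mathcal M\otimes\mathcal A$ let $G_\pi$ be the graph of the vertices and edges visited by $\pi$. If $\pi$ has a suffix $\kappa$ such that $G_\kappa$ is a bottom strongly connected component of $G_\pi$ (a single vertex being strongly connected only if it has a self-loop,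 and the empty graph not being strongly connected), the candidate $K(\pi)$ is the set of states of $\kappa$; otherwise $K(\pi):=\bot$. The path $\pi$ is bad if $K(\pi)\ne\bot$ and there is no $(E,F)\in Acc$ with $K(\pi)\cap(S\times E)=\emptyset$ and $K(\pi)\cap (S\times F)\neq\emptyset$. If $K(\pi)\ne\bot$, write $\pi=\pi' s\kappa$ with $\pi'$ the shortest prefix such that $K(\pi's)=K(\pi)$; then $\mathrm{Str}(\pi)$ is the largest $k$ such that every state of $K(\pi)$ occurs at least $k$ times in $s\kappa$ and the last state of $s\kappa$ occurs in it at least $k+1$ times. If $K(\pi)=\bot$, $\mathrm{Str}(\pi):=0$. The candidate index $i(\pi)$ is obtained by running through the nonempty prefixes $\pi'$ of $\pi$ in increasing length, starting with $C=\bot$, $i=0$, and setting $C:=K(\pi')$, $i:=i+1$ whenever $\bot\ne K(\pi')\neq C$. Let $\varepsilon>0$, and let $(\alpha_j)_{j\ge1}$ be a non-decreasing sequence of natural numbers with $\alpha_1=1$ and $\lim_j\alpha_j=\infty$. BoldMonitor$_\varepsilon$ with this sequence repeatedly samples a path of $\mathcal M\otimes\mathcal A$ from scratch; during the $j$-th sample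 it extends the current path $\pi$ step by step, and it resets (and starts the $(j+1)$-th sample) as soon as $\pi$ is bad and $\mathrm{Str}(\pi)\ge\alpha_j\,(i(\pi)-\log_2\varepsilon)$. Formally, let $\mathcal B$ be the Markov chain with states $\langle\pi,r\rangle$ ($\pi$ a finite sequence of states of $\mathcal M\otimes\mathcal A$, $r\in\mathbb N$) that starts in $\langle\lambda,0\rangle$ ($\lambda$ the empty path), moves from $\langle\pi,r\rangle$ to $\langle\lambda,r+1\rangle$ with probability $1$ if $\pi$ is bad and $\mathrm{Str}(\pi)\ge\alpha_{r+1}(i(\pi)-\log_2\varepsilon)$, and otherwise moves to $\langle\pi.p,r\rangle$ with the probability that $\mathcal M\otimes\mathcal A$ moves from the last state of $\pi$ to $p$ (starts in $p$, if $\pi=\lambda$). Let $R$ be the supremum of the second components along a run of $\mathcal B$ (the number of resets), and let $S_\varphi$ be the set of runs of $\mathcal B$ with $R<\infty$ for which the infinite path of $\mathcal M\otimes\mathcal A$ executed after the last reset satisfies $\varphi$. Let $p_{\min}$ be the smallest positive transition probability of $\mathcal M$ (which the monitor does not use), and $\alpha_0:=\max\{1,-1/\log_2(1-p_{\min})\}$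 (read as $1$ if $p_{\min}=1$). **Claim.** (a) $\mathbb P_{\mathcal B}[R<\infty]=1$. (b) $\mathbb P_{\mathcal B}[S_\varphi\mid R<\infty]=\mathbb P_{\mathcal B}[S_\varphi]=1$. (c) If moreover $\varepsilon<1$, then $\displaystyle\mathbb E(R)\le j_{\min}+\frac1{p_\varphi(1-\varepsilon)}$, where $j_{\min}$ is the smallest index $j\ge1$ with $\alpha_j\ge\alpha_0$. -/

import Mathlib

open MeasureTheory ProbabilityTheory Filter
open scoped ENNReal

namespace BoldMonitor

/-! ## Finite paths, their graphs, and bottom strongly connected components -/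

/-- A directed graph with its own vertex set `verts` and edge relation `Adj ⊆ verts × verts`. -/
structure DiGraph (V : Type*) where
  verts : Set V
  Adj : V → V → Prop
  left_mem : ∀ {v w}, Adj v w → v ∈ verts
  right_mem : ∀ {v w}, Adj v w → w ∈ verts

namespace DiGraph

variable {V : Type*}

/-- `H ≼ G`. -/
def IsSubgraph (H G : DiGraph V) : Prop :=
  H.verts ⊆ G.verts ∧ ∀ v w, H.Adj v w → G.Adj v w

/-- Any vertex reaches any vertex by a path with at least one edge, and there is a vertex.
So a single vertex counts as strongly connected only if it carries a self-loop. -/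
def StronglyConnected (G : DiGraph V) : Prop :=
  G.verts.Nonempty ∧ ∀ v ∈ G.verts, ∀ w ∈ G.verts, Relation.TransGen G.Adj v w

/-- `H` is a strongly connected component of `G`: a maximal strongly connected subgraph. -/
def IsSCC (H G : DiGraph V) : Prop :=
  H.IsSubgraph G ∧ H.StronglyConnected ∧
    ∀ H' : DiGraph V, H.IsSubgraph H' → H'.IsSubgraph G → H'.StronglyConnected → H' = H

/-- `H` is a bottom strongly connected component of `G`. -/
def IsBSCC (H G : DiGraph V) : Prop :=
  H.IsSCC G ∧ ∀ v w, v ∈ H.verts → G.Adj v w → w ∈ H.verts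

end DiGraph

section Paths

variable {V : Type*}

/-- The support of a finite path: the set of its vertices. -/
def support (p : List V) : Set V := {v | v ∈ p}

/-- The graph of a finite path: the visited vertices and the traversed edges. -/
def pathGraph (p : List V) : DiGraph V where
  verts := support p
  Adj v w := [v, w] <:+: p
  left_mem h := h.subset (by simp)
  right_mem h := h.subset (by simp)

/-- `C` is the support of a suffix `κ` of `p` whose graph is a BSCC of the graph of `p`. -/
def IsCandidate (p : List V) (C : Set V) : Prop :=
  ∃ κ : List V, κ <:+ p ∧ (pathGraph κ).IsBSCC (pathGraph p) ∧ support κ = C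

open Classical in
/-- The candidate `K(p)` of a finite path `p`; `none` stands for `⊥`. -/
noncomputable def candidate (p : List V) : Option (Set V) :=
  if h : ∃ C, IsCandidate p C then some h.choose else none

/-- The length of the shortest prefix `p'` of `p` such that `p = p' s κ` with
`K(p' s) = K(p)`. -/
noncomputable def birth (p : List V) : ℕ :=
  sInf {b | b < p.length ∧ candidate (p.take (b + 1)) = candidate p}

open Classical in
/-- `Str(p)`: with `p = p' s κ` for the shortest prefix `p'` such that `K(p' s) = K(p)`, the
largest `k` such that every state of `K(p)` occurs at least `k` times in `s κ` and the last
state of `s κ` occurs there at least `k + 1` times. It is `0` if `K(p) = ⊥`. -/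
noncomputable def strength (p : List V) : ℕ :=
  match candidate p with
  | none => 0
  | some C =>
      sSup {k | (∀ v ∈ C, k ≤ (p.drop (birth p)).count v) ∧
        ∀ v, p.getLast? = some v → k + 1 ≤ (p.drop (birth p)).count v}

open Classical in
/-- One update of the pair `(C, i)` (current candidate, candidate counter) of the monitor, when
the current path has become `p`. -/
noncomputable def updateCandidate (Ci : Option (Set V) × ℕ) (p : List V) : Option (Set V) × ℕ :=
  if candidate p ≠ none ∧ candidate p ≠ Ci.1 then (candidate p, Ci.2 + 1) else Ci

/-- The value of the candidate counter `i` of the monitor after it has executed the path `p`: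
start from `(⊥, 0)` and update along all prefixes of `p`. -/
noncomputable def candidateIndex (p : List V) : ℕ :=
  (p.inits.foldl updateCandidate (none, 0)).2

end Paths

/-! ## Markov chains -/

/-- A (possibly infinite-state) Markov chain with state space `X`. -/
structure MarkovChain (X : Type*) where
  /-- `trans x y` is the transition probability from `x` to `y` -/
  trans : X → PMF X
  /-- the initial distribution -/
  init : PMF X

/-- Infinite sequences of states, with the σ-algebra generated by the coordinates, where all sets
of states are measurable. -/
def Run (X : Type*) : Type _ := ℕ → X

instance (X : Type*) : MeasurableSpace (Run X) :=
  @MeasurableSpace.pi ℕ (fun _ => X) (fun _ => ⊤)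

namespace MarkovChain

variable {X : Type*}

/-- The transition kernel from the states up to time `n` to the state at time `n + 1`. -/
noncomputable def stepKernel (M : MarkovChain X) (n : ℕ) :
    @Kernel ((i : Finset.Iic n) → X) X (@MeasurableSpace.pi _ _ (fun _ => ⊤)) ⊤ :=
  letI : MeasurableSpace X := ⊤
  { toFun := fun x => (M.trans (x ⟨n, Finset.mem_Iic.2 le_rfl⟩)).toMeasure
    measurable' :=
      (measurable_from_top (f := fun y : X => (M.trans y).toMeasure)).comp
        (measurable_pi_apply _) }

instance (M : MarkovChain X) (n : ℕ) :
    @IsMarkovKernel _ _ (@MeasurableSpace.pi _ _ (fun _ => ⊤)) ⊤ (M.stepKernel n) :=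
  letI : MeasurableSpace X := ⊤
  ⟨fun x => PMF.toMeasure.isProbabilityMeasure (M.trans (x ⟨n, Finset.mem_Iic.2 le_rfl⟩))⟩

/-- The probability measure of the Markov chain on its runs. -/
noncomputable def runMeasure (M : MarkovChain X) : Measure (Run X) :=
  letI : MeasurableSpace X := ⊤
  Kernel.trajMeasure (X := fun _ => X) M.init.toMeasure M.stepKernel

instance (M : MarkovChain X) : IsProbabilityMeasure M.runMeasure :=
  letI : MeasurableSpace X := ⊤
  inferInstanceAs (IsProbabilityMeasure
    (Kernel.trajMeasure (X := fun _ => X) M.init.toMeasure M.stepKernel))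

/-- The defining property of the probability measure on runs: the cone of `s 0, …, s k` has
probability `μ(s 0) * ∏_{i < k} P(s i, s (i+1))`. -/
theorem runMeasure_cone (M : MarkovChain X) (s : ℕ → X) (k : ℕ) :
    M.runMeasure {ρ | ∀ i ≤ k, ρ i = s i} =
      M.init (s 0) * ∏ i ∈ Finset.range k, M.trans (s i) (s (i + 1)) := by
  let _ : MeasurableSpace X := ⊤
  have hsing : ∀ y : X, MeasurableSet ({y} : Set X) := fun y => trivial
  have : MeasurableSingletonClass X := ⟨hsing⟩
  change Kernel.trajMeasure (X := fun _ => X) M.init.toMeasure M.stepKernel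
    {ρ : ℕ → X | ∀ i ≤ k, ρ i = s i} = _
  set μ := Kernel.trajMeasure (X := fun _ => X) M.init.toMeasure M.stepKernel with hμ
  induction k with
  | zero =>
    have h0 : {ρ : ℕ → X | ∀ i ≤ 0, ρ i = s i} =
        (Preorder.frestrictLe (π := fun _ => X) 0) ⁻¹'
          {Preorder.frestrictLe (π := fun _ => X) 0 s} := by
      ext ρ
      simp only [Set.mem_ofPred_eq, Set.mem_preimage, Set.mem_singleton_iff]
      constructor
      · intro h
        funext i
        exact h i.1 (Finset.mem_Iic.1 i.2)
      · intro h i hi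
        exact congrFun h ⟨i, Finset.mem_Iic.2 hi⟩
    rw [h0, ← Measure.map_apply (by fun_prop) (MeasurableSet.singleton _), hμ,
      Kernel.trajMeasure, Measure.map_comp _ _ (by fun_prop), Kernel.traj_map_frestrictLe,
      Kernel.partialTraj_self, Measure.id_comp,
      Measure.map_apply (MeasurableEquiv.measurable _) (MeasurableSet.singleton _)]
    have h1 : (MeasurableEquiv.piUnique (fun i : Finset.Iic 0 => X)).symm ⁻¹'
        {Preorder.frestrictLe (π := fun _ => X) 0 s} = {s 0} := by
      ext y
      simp only [Set.mem_preimage, Set.mem_singleton_iff]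
      rw [MeasurableEquiv.symm_apply_eq]
      rfl
    simp only [Finset.range_zero, Finset.prod_empty, mul_one]
    refine Eq.trans (congrArg _ h1) ?_
    exact PMF.toMeasure_apply_singleton _ _ (hsing _)
  | succ k ih =>
    have h0 : {ρ : ℕ → X | ∀ i ≤ k + 1, ρ i = s i} =
        (fun x : ℕ → X => (Preorder.frestrictLe (π := fun _ => X) k x, x (k + 1))) ⁻¹'
          ({Preorder.frestrictLe (π := fun _ => X) k s} ×ˢ {s (k + 1)}) := by
      ext ρ
      simp only [Set.mem_ofPred_eq, Set.mem_preimage, Set.mem_prod, Set.mem_singleton_iff]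
      constructor
      · intro h
        refine ⟨?_, h _ le_rfl⟩
        funext i
        exact h i.1 ((Finset.mem_Iic.1 i.2).trans (Nat.le_succ k))
      · rintro ⟨h, h'⟩ i hi
        rcases Nat.le_succ_iff.1 hi with hi | rfl
        · exact congrFun h ⟨i, Finset.mem_Iic.2 hi⟩
        · exact h'
    have hk : {ρ : ℕ → X | ∀ i ≤ k, ρ i = s i} =
        (Preorder.frestrictLe (π := fun _ => X) k) ⁻¹'
          {Preorder.frestrictLe (π := fun _ => X) k s} := by
      ext ρ
      simp only [Set.mem_ofPred_eq, Set.mem_preimage, Set.mem_singleton_iff]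
      constructor
      · intro h
        funext i
        exact h i.1 (Finset.mem_Iic.1 i.2)
      · intro h i hi
        exact congrFun h ⟨i, Finset.mem_Iic.2 hi⟩
    rw [hk, ← Measure.map_apply (by fun_prop) (MeasurableSet.singleton _)] at ih
    rw [h0, ← Measure.map_apply (by fun_prop)
      ((MeasurableSet.singleton _).prod (MeasurableSet.singleton _)), hμ,
      ← Kernel.map_frestrictLe_trajMeasure_compProd_eq_map_trajMeasure,
      Measure.compProd_apply_prod (MeasurableSet.singleton _) (MeasurableSet.singleton _),
      Measure.restrict_singleton, lintegral_smul_measure, lintegral_dirac, ← hμ, ih,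
      Finset.prod_range_succ, smul_eq_mul, mul_assoc]
    congr 2
    exact PMF.toMeasure_apply_singleton _ _ (hsing _)

/-- The smallest positive transition probability of a finite-state chain. -/
noncomputable def minProb (M : MarkovChain X) : ℝ :=
  sInf {p | 0 < p ∧ ∃ x y, p = (M.trans x y).toReal}

/-- `α₀ = max {1, -1 / log (1 - p_min)}`, with the logarithm to base `2`. If `p_min = 1` the second
entry is `0`, as `log 0 = 0` and `-1 / 0 = 0` in Lean. -/
noncomputable def alphaZero (M : MarkovChain X) : ℝ :=
  max 1 (-1 / Real.logb 2 (1 - M.minProb))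

end MarkovChain

/-- A Markov chain whose states are labelled by sets of atomic propositions. -/
structure LabelledMarkovChain (S Ap : Type*) extends MarkovChain S where
  label : S → Set Ap

/-! ## Linear temporal logic -/

/-- Formulas of linear temporal logic over the atomic propositions `Ap`. -/
inductive LTL (Ap : Type*) where
  | tt : LTL Ap
  | atom : Ap → LTL Ap
  | neg : LTL Ap → LTL Ap
  | and : LTL Ap → LTL Ap → LTL Ap
  | next : LTL Ap → LTL Ap
  | until : LTL Ap → LTL Ap → LTL Ap

/-- `φ.Sat w`: the infinite word `w` satisfies `φ`. -/
def LTL.Sat {Ap : Type*} : LTL Ap → (ℕ → Set Ap) → Prop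
  | .tt, _ => True
  | .atom a, w => a ∈ w 0
  | .neg φ, w => ¬ φ.Sat w
  | .and φ ψ, w => φ.Sat w ∧ ψ.Sat w
  | .next φ, w => φ.Sat (fun n => w (n + 1))
  | .until φ ψ, w =>
      ∃ j, ψ.Sat (fun n => w (n + j)) ∧ ∀ i < j, φ.Sat (fun n => w (n + i))

/-- `P[M ⊨ φ]`. -/
noncomputable def LabelledMarkovChain.prob {S Ap : Type*} (M : LabelledMarkovChain S Ap)
    (φ : LTL Ap) : ℝ≥0∞ :=
  M.runMeasure {ρ | φ.Sat (fun n => M.label (ρ n))}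

/-! ## Deterministic Rabin automata and the product chain -/

/-- A deterministic Rabin automaton with states `Q` over the alphabet `2^Ap`. -/
structure DRA (Q Ap : Type*) where
  step : Q → Set Ap → Q
  start : Q
  /-- the Rabin pairs `(E, F)` -/
  acc : Set (Set Q × Set Q)

namespace DRA

variable {Q Ap S : Type*}

/-- The state after reading the first `n` letters of `w`. -/
def stateAt (A : DRA Q Ap) (w : ℕ → Set Ap) : ℕ → Q
  | 0 => A.start
  | n + 1 => A.step (A.stateAt w n) (w n)

/-- For some Rabin pair `(E, F)`, states of `E` are visited only finitely often and states of `F`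
infinitely often. -/
def Accepts (A : DRA Q Ap) (w : ℕ → Set Ap) : Prop :=
  ∃ EF ∈ A.acc, (∀ᶠ n in atTop, A.stateAt w n ∉ EF.1) ∧ ∃ᶠ n in atTop, A.stateAt w n ∈ EF.2

/-- `A` is an automaton for `φ`: it accepts exactly the words that satisfy `φ`. -/
def Recognizes (A : DRA Q Ap) (φ : LTL Ap) : Prop :=
  ∀ w, A.Accepts w ↔ φ.Sat w

/-- A set `K` of states of the product is good if for some Rabin pair `(E, F)` it is disjoint from
`S × E` and meets `S × F`. -/
def GoodSet (A : DRA Q Ap) (K : Set (S × Q)) : Prop :=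
  ∃ EF ∈ A.acc, (∀ x ∈ K, x.2 ∉ EF.1) ∧ ∃ x ∈ K, x.2 ∈ EF.2

/-- `Bad(p)`: the path `p` has a candidate, and the candidate is bad. -/
def Bad (A : DRA Q Ap) (p : List (S × Q)) : Prop :=
  ∃ K, candidate p = some K ∧ ¬ A.GoodSet K

end DRA

section Monitor

variable {S Q Ap : Type*}

/-- The product chain `M ⊗ A`. -/
noncomputable def product (M : LabelledMarkovChain S Ap) (A : DRA Q Ap) :
    MarkovChain (S × Q) where
  trans x := (M.trans x.1).map (fun s' => (s', A.step x.2 (M.label s')))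
  init := M.init.map (fun s => (s, A.step A.start (M.label s)))

open Classical in
/-- The transition matrix of the product chain. -/
theorem product_trans_apply (M : LabelledMarkovChain S Ap) (A : DRA Q Ap) (x y : S × Q) :
    (product M A).trans x y =
      if y.2 = A.step x.2 (M.label y.1) then M.trans x.1 y.1 else 0 := by
  obtain ⟨s, q⟩ := y
  simp only [product, PMF.map_apply, Prod.mk.injEq]
  rw [tsum_eq_single s (fun s' hs' => if_neg (fun h => hs' h.1.symm))]
  simp

open Classical in
/-- The initial distribution of the product chain. -/
theorem product_init_apply (M : LabelledMarkovChain S Ap) (A : DRA Q Ap) (x : S × Q) :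
    (product M A).init x = if A.step A.start (M.label x.1) = x.2 then M.init x.1 else 0 := by
  obtain ⟨s, q⟩ := x
  simp only [product, PMF.map_apply, Prod.mk.injEq]
  rw [tsum_eq_single s (fun s' hs' => if_neg (fun h => hs' h.1.symm))]
  simp [eq_comm]

/-- The law of the next state of the chain after the finite path `p`: the initial distribution if
`p` is empty, else the transition distribution of the last state of `p`. -/
noncomputable def nextState {X : Type*} (N : MarkovChain X) (p : List X) : PMF X :=
  match p.getLast? with
  | none => N.init
  | some x => N.trans x

/-- The exit condition of the sampling loop with parameters `α` and `ε`, for the current path `p`: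
`Bad(p)` and `Str(p) ≥ α (i - log ε)`, where `i` is the candidate counter. -/
def ExitCond (A : DRA Q Ap) (α : ℕ) (ε : ℝ) (p : List (S × Q)) : Prop :=
  A.Bad p ∧ (α : ℝ) * ((candidateIndex p : ℝ) - Real.logb 2 ε) ≤ (strength p : ℝ)

open Classical in
/-- The infinite-state Markov chain of the execution of the bold monitor on `M ⊗ A` for the sequence
`α 1, α 2, …`. A state `(p, r)` consists of the current path `p` and the number `r` of resets so
far; the current sample is the `(r + 1)`-th one, so that its parameter is `α (r + 1)`. -/
noncomputable def boldChain (M : LabelledMarkovChain S Ap) (A : DRA Q Ap) (α : ℕ → ℕ) (ε : ℝ) :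
    MarkovChain (List (S × Q) × ℕ) where
  trans x :=
    if ExitCond A (α (x.2 + 1)) ε x.1 then PMF.pure ([], x.2 + 1)
    else (nextState (product M A) x.1).map (fun y => (x.1 ++ [y], x.2))
  init := PMF.pure ([], 0)

/-- The number `R` of resets of a run of the monitor. -/
noncomputable def resets (ρ : Run (List (S × Q) × ℕ)) : ℕ∞ :=
  ⨆ n, ((ρ n).2 : ℕ∞)

/-- The set `S_φ` of runs of the monitor with finitely many resets, and such that from the time `N`
immediately after the last reset the monitor executes, prefix by prefix, an infinite path `w` of
the product (starting from the empty path) which satisfies `φ`. -/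
def satRuns (M : LabelledMarkovChain S Ap) (φ : LTL Ap) : Set (Run (List (S × Q) × ℕ)) :=
  {ρ | resets ρ < ⊤ ∧ ∃ (N : ℕ) (w : ℕ → S × Q), ((ρ N).2 : ℕ∞) = resets ρ ∧
    (∀ n, ρ (N + n) = ((List.range n).map w, (ρ N).2)) ∧ φ.Sat (fun n => M.label (w n).1)}

end Monitor

end BoldMonitor

/-! Let G be the union of the closed communicating classes of the product chain that satisfy the
Rabin condition, and H the probability that the product reaches G. Almost surely the states visited
infinitely often form a closed class, so the probability of φ is at most H (`prob_le_absorbAfter`).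
The probability bounds rest on superharmonic functions of the finite history: if such a function is
eventually at least 1 on an event, its initial value bounds the probability of the event
(`measure_le_of_eventually_le`). `hitProb_add_le` is the analogue for hitting a set of finite paths.

(a) Since H > 0, a good class B is reachable, and it contains a state f that meets the second set of
a Rabin pair whose first set B avoids. With positive probability B is explored so that every
candidate lies in B and contains f, hence is good (`hitProb_nil_lt_one`). So each sample resets with
probability at most some θ < 1 that does not depend on its parameter, and m resets have probability
at most θ^m.

(b) In the last sample the recurrent states almost surely form a closed class. This class becomes
the candidate; from then on the counter is constant and the strength unbounded
(`exists_le_strength`). A bad class would thus force another reset, so the class is good and the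
path is accepted.

(c) A sample that reaches G can only reset on a candidate that is not closed. By the maximum
principle such a candidate has a transition to the outside along which the probability of reaching G
does not decrease (`exists_exit`). Weighted by that probability, each departure from the source of
this transition stays inside with a factor at most 1 - p_min. Once the parameter is at least α₀, the
i-th candidate costs at most H ε 2^(-i) in total weight, and the costs sum to at most H ε. Hence a
sample resets with probability at most 1 - H (1 - ε) (`hitProb_exitSet_le`), and the expectation is
bounded by j_min plus a geometric series (`tsum_prod_le`). -/

namespace BoldMonitor

/-! ## Means with respect to discrete distributions -/

section Mean

variable {X Y : Type*}

/-- The mean of a nonnegative function with respect to a discrete distribution. -/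
noncomputable def mean (p : PMF X) (f : X → ℝ≥0∞) : ℝ≥0∞ := ∑' x, p x * f x

theorem mean_const (p : PMF X) (c : ℝ≥0∞) : mean p (fun _ => c) = c := by
  simp [mean, ENNReal.tsum_mul_right, p.tsum_coe]

theorem mean_add (p : PMF X) (f g : X → ℝ≥0∞) :
    mean p (fun x => f x + g x) = mean p f + mean p g := by
  simp only [mean, mul_add]
  exact ENNReal.tsum_add

theorem mean_mul_right (p : PMF X) (f : X → ℝ≥0∞) (c : ℝ≥0∞) :
    mean p (fun x => f x * c) = mean p f * c := by
  simp only [mean, ← mul_assoc, ENNReal.tsum_mul_right]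

theorem mean_mono {p : PMF X} {f g : X → ℝ≥0∞} (h : ∀ x, p x ≠ 0 → f x ≤ g x) :
    mean p f ≤ mean p g := by
  refine ENNReal.tsum_le_tsum fun x => ?_
  by_cases hx : p x = 0
  · simp [hx]
  · exact mul_le_mul_right (h x hx) _

theorem mean_congr {p : PMF X} {f g : X → ℝ≥0∞} (h : ∀ x, p x ≠ 0 → f x = g x) :
    mean p f = mean p g :=
  le_antisymm (mean_mono fun x hx => (h x hx).le) (mean_mono fun x hx => (h x hx).ge)

theorem mean_le {p : PMF X} {f : X → ℝ≥0∞} {c : ℝ≥0∞} (h : ∀ x, p x ≠ 0 → f x ≤ c) :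
    mean p f ≤ c :=
  (mean_mono h).trans (mean_const p c).le

theorem mean_pure (x : X) (f : X → ℝ≥0∞) : mean (PMF.pure x) f = f x := by
  classical
  rw [mean, tsum_eq_single x]
  · simp
  · intro y hy
    simp [hy]

theorem mean_map (p : PMF X) (g : X → Y) (f : Y → ℝ≥0∞) :
    mean (p.map g) f = mean p (fun x => f (g x)) := by
  classical
  simp only [mean, PMF.map_apply, ← ENNReal.tsum_mul_right]
  rw [ENNReal.tsum_comm]
  refine tsum_congr fun x => ?_
  rw [tsum_eq_single (g x)]
  · simp
  · intro y hy
    simp [hy]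

theorem mul_le_mean (p : PMF X) (f : X → ℝ≥0∞) (x : X) : p x * f x ≤ mean p f :=
  ENNReal.le_tsum x

theorem mean_iSup [Finite X] (p : PMF X) (f : ℕ → X → ℝ≥0∞) (hf : Monotone f) :
    mean p (fun x => ⨆ n, f n x) = ⨆ n, mean p (f n) := by
  cases nonempty_fintype X
  simp only [mean, tsum_fintype, ENNReal.mul_iSup]
  rw [ENNReal.finsetSum_iSup_of_monotone]
  intro x m n hmn
  exact mul_le_mul_right (hf hmn x) _

/-- One smaller value of positive weight would make the mean strictly smaller than `c`. This is the
equality case behind the maximum principle and behind the propagation of `hitProb < 1`. -/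
theorem eq_of_le_mean {p : PMF X} {f : X → ℝ≥0∞} {c : ℝ≥0∞} (hc : c ≠ ∞)
    (hf : ∀ x, p x ≠ 0 → f x ≤ c) (h : c ≤ mean p f) {x : X} (hx : p x ≠ 0) : f x = c := by
  by_contra hne
  have hlt : f x < c := lt_of_le_of_ne (hf x hx) hne
  have h1 : ∑' y, p y * f y < ∑' y, p y * c := by
    refine ENNReal.tsum_lt_tsum (i := x) (ne_top_of_le_ne_top hc (mean_le hf)) (fun y => ?_) ?_
    · by_cases hy : p y = 0
      · simp [hy]
      · exact mul_le_mul_right (hf y hy) _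
    · exact ENNReal.mul_lt_mul_right hx (p.apply_ne_top x) hlt
  have h2 : ∑' y, p y * c = c := mean_const p c
  rw [h2] at h1
  exact absurd h1 (not_lt.2 h)

end Mean

/-! ## Prefixes of runs -/

section Prefixes

/-- A run as a function of time. -/
def Run.states {X : Type*} (ρ : Run X) : ℕ → X := ρ

variable {X : Type*}

/-- The first `n` states of an infinite sequence. -/
def runPrefix (ρ : ℕ → X) (n : ℕ) : List X := (List.range n).map ρ

@[simp] theorem runPrefix_zero (ρ : ℕ → X) : runPrefix ρ 0 = [] := rfl

theorem runPrefix_succ (ρ : ℕ → X) (n : ℕ) : runPrefix ρ (n + 1) = runPrefix ρ n ++ [ρ n] := by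
  simp [runPrefix, List.range_succ]

@[simp] theorem length_runPrefix (ρ : ℕ → X) (n : ℕ) : (runPrefix ρ n).length = n := by
  simp [runPrefix]

theorem runPrefix_eq_iff (ρ s : ℕ → X) (n : ℕ) :
    runPrefix ρ n = runPrefix s n ↔ ∀ i < n, ρ i = s i := by
  simp [runPrefix]

theorem take_runPrefix (ρ : ℕ → X) {k n : ℕ} (h : k ≤ n) :
    (runPrefix ρ n).take k = runPrefix ρ k := by
  rw [runPrefix, ← List.map_take, List.take_range, min_eq_left h, runPrefix]

end Prefixes

/-! ## Finite-horizon identities for Markov chains -/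

section Chain

variable {X : Type*} (M : MarkovChain X)

@[simp] theorem nextState_nil : nextState M [] = M.init := rfl

@[simp] theorem nextState_concat (l : List X) (x : X) : nextState M (l ++ [x]) = M.trans x := by
  simp [nextState]

theorem runMeasure_cone_states (s : ℕ → X) (k : ℕ) :
    M.runMeasure {ρ | ∀ i ≤ k, ρ.states i = s i} =
      M.init (s 0) * ∏ i ∈ Finset.range k, M.trans (s i) (s (i + 1)) :=
  M.runMeasure_cone s k

theorem measurable_states_apply (n : ℕ) :
    @Measurable (Run X) X _ ⊤ (fun ρ => ρ.states n) := by
  let _ : MeasurableSpace X := ⊤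
  exact measurable_pi_apply (X := fun _ : ℕ => X) n

theorem measurableSet_coord (n : ℕ) (B : Set X) : MeasurableSet {ρ : Run X | ρ.states n ∈ B} := by
  let _ : MeasurableSpace X := ⊤
  exact measurable_states_apply n (show MeasurableSet B from trivial)

theorem measurableSet_runPrefix_eq (n : ℕ) (l : List X) :
    MeasurableSet {ρ : Run X | runPrefix ρ.states n = l} := by
  by_cases h : ∃ s : ℕ → X, runPrefix s n = l
  · obtain ⟨s, rfl⟩ := h
    have : {ρ : Run X | runPrefix ρ.states n = runPrefix s n} = ⋂ i, ⋂ (_ : i < n), {ρ | ρ.states i ∈ ({s i} : Set X)} := by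
      ext ρ
      simp [runPrefix_eq_iff]
    rw [this]
    exact MeasurableSet.iInter fun i => MeasurableSet.iInter fun _ => measurableSet_coord i _
  · have : {ρ : Run X | runPrefix ρ.states n = l} = ∅ := by
      ext ρ
      simp only [Set.mem_ofPred_eq, Set.mem_empty_iff_false, iff_false]
      exact fun h' => h ⟨ρ.states, h'⟩
    rw [this]
    exact MeasurableSet.empty

/-- The Markov property, read off from the cone formula. If `l` is not the prefix of length `n` of
any sequence, both events are empty. -/
theorem runMeasure_prefix_concat (n : ℕ) (l : List X) (y : X) :
    M.runMeasure {ρ | runPrefix ρ.states n = l ∧ ρ.states n = y} =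
      M.runMeasure {ρ | runPrefix ρ.states n = l} * nextState M l y := by
  by_cases h : ∃ s : ℕ → X, runPrefix s n = l
  · obtain ⟨s', hs'⟩ := h
    obtain ⟨s, hs, hy⟩ : ∃ s : ℕ → X, runPrefix s n = l ∧ s n = y := by
      classical
      refine ⟨Function.update s' n y, ?_, by simp⟩
      rw [← hs', runPrefix_eq_iff]
      intro i hi
      simp [hi.ne]
    subst hs hy
    have h1 : {ρ : Run X | runPrefix ρ.states n = runPrefix s n ∧ ρ.states n = s n} = {ρ | ∀ i ≤ n, ρ.states i = s i} := by
      ext ρ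
      simp only [runPrefix_eq_iff, Set.mem_ofPred_eq]
      constructor
      · rintro ⟨h, h'⟩ i hi
        rcases hi.lt_or_eq with hi | rfl
        · exact h i hi
        · exact h'
      · exact fun h => ⟨fun i hi => h i hi.le, h n le_rfl⟩
    rw [h1, runMeasure_cone_states]
    cases n with
    | zero => simp
    | succ n =>
      have h2 : {ρ : Run X | runPrefix ρ.states (n + 1) = runPrefix s (n + 1)} = {ρ | ∀ i ≤ n, ρ.states i = s i} := by
        ext ρ
        simp [runPrefix_eq_iff]
      rw [h2, runMeasure_cone_states, runPrefix_succ, nextState_concat, Finset.prod_range_succ, mul_assoc]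
  · have h1 : {ρ : Run X | runPrefix ρ.states n = l} = ∅ := by
      ext ρ
      simp only [Set.mem_ofPred_eq, Set.mem_empty_iff_false, iff_false]
      exact fun h' => h ⟨ρ.states, h'⟩
    have h2 : {ρ : Run X | runPrefix ρ.states n = l ∧ ρ.states n = y} = ∅ := by
      ext ρ
      simp only [Set.mem_ofPred_eq, Set.mem_empty_iff_false, iff_false]
      exact fun h' => h ⟨ρ.states, h'.1⟩
    rw [h1, h2]
    simp

variable [Countable X]

theorem measurable_runPrefix (n : ℕ) :
    @Measurable (Run X) (List X) _ ⊤ (fun ρ => runPrefix ρ.states n) := by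
  let _ : MeasurableSpace (List X) := ⊤
  exact measurable_to_countable' fun l => measurableSet_runPrefix_eq n l

theorem measurable_runPrefix_comp {Y : Type*} [MeasurableSpace Y] (f : List X → Y) (n : ℕ) :
    Measurable (fun ρ : Run X => f (runPrefix ρ.states n)) := by
  let _ : MeasurableSpace (List X) := ⊤
  exact (measurable_from_top (f := f)).comp (measurable_runPrefix n)

theorem lintegral_runPrefix_coord (n : ℕ) (F : List X → X → ℝ≥0∞) :
    ∫⁻ ρ, F (runPrefix ρ.states n) (ρ.states n) ∂M.runMeasure =
      ∫⁻ ρ, mean (nextState M (runPrefix ρ.states n)) (F (runPrefix ρ.states n)) ∂M.runMeasure := by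
  let _ : MeasurableSpace (List X) := ⊤
  let _ : MeasurableSpace X := ⊤
  have m1 : Measurable (fun ρ : Run X => runPrefix ρ.states n) := measurable_runPrefix n
  have m2 : Measurable (fun ρ : Run X => ρ.states n) := measurable_states_apply n
  have e1 : ∫⁻ ρ, F (runPrefix ρ.states n) (ρ.states n) ∂M.runMeasure =
      ∫⁻ z, F z.1 z.2 ∂(M.runMeasure.map (fun ρ => (runPrefix ρ.states n, ρ.states n))) :=
    (lintegral_map (f := fun z : List X × X => F z.1 z.2) (Measurable.of_discrete)
      (m1.prodMk m2)).symm
  have e2 : ∫⁻ ρ, mean (nextState M (runPrefix ρ.states n)) (F (runPrefix ρ.states n)) ∂M.runMeasure =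
      ∫⁻ l, mean (nextState M l) (F l) ∂(M.runMeasure.map (fun ρ => runPrefix ρ.states n)) :=
    (lintegral_map (f := fun l : List X => mean (nextState M l) (F l)) (Measurable.of_discrete)
      m1).symm
  rw [e1, e2, lintegral_countable', lintegral_countable', ENNReal.tsum_prod']
  refine tsum_congr fun l => ?_
  rw [mean, ← ENNReal.tsum_mul_right]
  refine tsum_congr fun y => ?_
  rw [Measure.map_apply (m1.prodMk m2) (MeasurableSet.singleton _),
    Measure.map_apply m1 (MeasurableSet.singleton _)]
  have := runMeasure_prefix_concat M n l y
  have h1 : (fun ρ : Run X => (runPrefix ρ.states n, ρ.states n)) ⁻¹' {(l, y)} =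
      {ρ | runPrefix ρ.states n = l ∧ ρ.states n = y} := by
    ext ρ
    simp
  rw [h1, this]
  change F l y * (_ * _) = _ * M.runMeasure {ρ | runPrefix ρ.states n = l}
  ring

/-- The mean of a superharmonic function of the history does not increase. -/
theorem lintegral_runPrefix_le (f : List X → ℝ≥0∞)
    (hf : ∀ l, mean (nextState M l) (fun y => f (l ++ [y])) ≤ f l) (n : ℕ) :
    ∫⁻ ρ, f (runPrefix ρ.states n) ∂M.runMeasure ≤ f [] := by
  induction n with
  | zero => simp
  | succ n ih =>
    simp only [runPrefix_succ]
    rw [lintegral_runPrefix_coord M n (fun l y => f (l ++ [y]))]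
    exact (lintegral_mono fun ρ => hf _).trans ih

/-- If a superharmonic function of the history is eventually at least `1` on an event, then the
event has probability at most the initial value of the function. -/
theorem measure_le_of_eventually_le (f : List X → ℝ≥0∞)
    (hf : ∀ l, mean (nextState M l) (fun y => f (l ++ [y])) ≤ f l) (E : Set (Run X))
    (hE : ∀ᵐ ρ ∂M.runMeasure, ρ ∈ E → ∀ᶠ n in atTop, 1 ≤ f (runPrefix ρ.states n)) :
    M.runMeasure E ≤ f [] := by
  have hmeas : ∀ n, Measurable fun ρ : Run X => f (runPrefix ρ.states n) := fun n =>
    measurable_runPrefix_comp f n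
  have hlim : ∀ᵐ ρ ∂M.runMeasure, ρ ∈ E →
      1 ≤ liminf (fun n => f (runPrefix ρ.states n)) atTop := by
    filter_upwards [hE] with ρ hρ h
    exact le_liminf_of_le (by isBoundedDefault) (hρ h)
  -- Markov's inequality for the lower limit, then Fatou, then the decreasing means.
  calc M.runMeasure E
      ≤ M.runMeasure {ρ | 1 ≤ liminf (fun n => f (runPrefix ρ.states n)) atTop} :=
        measure_mono_ae hlim
    _ ≤ ∫⁻ ρ, liminf (fun n => f (runPrefix ρ.states n)) atTop ∂M.runMeasure := by
        have := mul_meas_ge_le_lintegral (μ := M.runMeasure) (Measurable.liminf hmeas) 1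
        rwa [one_mul] at this
    _ ≤ liminf (fun n => ∫⁻ ρ, f (runPrefix ρ.states n) ∂M.runMeasure) atTop :=
        lintegral_liminf_le hmeas
    _ ≤ liminf (fun _ : ℕ => f []) atTop :=
        liminf_le_liminf (Eventually.of_forall fun n => lintegral_runPrefix_le M f hf n)
    _ = f [] := by simp

/-- Transitions of probability zero have conditional mean zero at each time. Pathwise arguments may
therefore assume that all steps are edges of the transition graph. -/
theorem ae_nextState_ne_zero :
    ∀ᵐ ρ ∂M.runMeasure, ∀ n, nextState M (runPrefix ρ.states n) (ρ.states n) ≠ 0 := by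
  classical
  rw [ae_all_iff]
  intro n
  have h := lintegral_runPrefix_coord M n (fun l y => if nextState M l y = 0 then 1 else 0)
  have h0 : ∀ l, mean (nextState M l) (fun y => if nextState M l y = 0 then 1 else 0) = 0 := by
    intro l
    refine le_antisymm (mean_le fun y hy => ?_) bot_le
    simp [hy]
  simp only [h0, lintegral_zero] at h
  rw [lintegral_eq_zero_iff] at h
  · filter_upwards [h] with ρ hρ h'
    simp [h'] at hρ
  · let _ : MeasurableSpace (List X) := ⊤
    let _ : MeasurableSpace X := ⊤
    have m1 : Measurable (fun ρ : Run X => runPrefix ρ.states n) := measurable_runPrefix n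
    have m2 : Measurable (fun ρ : Run X => ρ.states n) := measurable_states_apply n
    exact (Measurable.of_discrete
      (f := fun z : List X × X => if nextState M z.1 z.2 = 0 then (1 : ℝ≥0∞) else 0)).comp
      (m1.prodMk m2)

open Classical in
/-- If an event of the history has conditional probability at least `δ` whenever the history lies
in `C`, and the history lies in `C` infinitely often, then the event occurs infinitely often. -/
theorem ae_frequently_of_frequently (C D : Set (List X)) {δ : ℝ≥0∞} (hδ : 0 < δ)
    (h : ∀ l ∈ C, δ ≤ mean (nextState M l) (fun y => if l ++ [y] ∈ D then 1 else 0)) :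
    ∀ᵐ ρ ∂M.runMeasure, (∃ᶠ n in atTop, runPrefix ρ.states n ∈ C) →
      ∃ᶠ n in atTop, runPrefix ρ.states n ∈ D := by
  suffices H : ∀ n₀ : ℕ, ∀ᵐ ρ ∂M.runMeasure, ¬ ((∃ᶠ n in atTop, runPrefix ρ.states n ∈ C) ∧
      ∀ n > n₀, runPrefix ρ.states n ∉ D) by
    filter_upwards [ae_all_iff.2 H] with ρ hρ hC
    rw [frequently_atTop]
    intro n₀
    by_contra! hD
    exact hρ n₀ ⟨hC, fun n hn => hD n hn.le⟩
  intro n₀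
  -- `c` counts the visits to `C` from time `n₀` on that have already been followed by a step, and
  -- `clean` says that `D` has been avoided after `n₀`. Then `g m` bounds the chance of staying
  -- clean until the `m`-th visit: each remaining visit costs a factor `1 - δ`.
  let c : List X → ℕ := fun l => ((Finset.Ico n₀ l.length).filter (fun k => l.take k ∈ C)).card
  let clean : List X → Prop := fun l => ∀ k, n₀ < k → k ≤ l.length → l.take k ∉ D
  let g : ℕ → List X → ℝ≥0∞ := fun m l => if clean l then (1 - δ) ^ (m - c l) else 0
  have h1δ : 1 - δ ≤ 1 := tsub_le_self
  have hc : ∀ l y, c (l ++ [y]) = c l + if n₀ ≤ l.length ∧ l ∈ C then 1 else 0 := by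
    intro l y
    have hf : ∀ k < l.length, ((l ++ [y]).take k ∈ C ↔ l.take k ∈ C) := fun k hk => by
      rw [List.take_append_of_le_length hk.le]
    by_cases hn : n₀ ≤ l.length
    · simp only [c, List.length_append, List.length_singleton]
      rw [← Finset.insert_Ico_right_eq_Ico_add_one hn, Finset.filter_insert]
      have e : ((Finset.Ico n₀ l.length).filter (fun k => (l ++ [y]).take k ∈ C)) =
          ((Finset.Ico n₀ l.length).filter (fun k => l.take k ∈ C)) :=
        Finset.filter_congr fun k hk => hf k (Finset.mem_Ico.1 hk).2
      rw [e, List.take_left]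
      by_cases hl : l ∈ C
      · rw [if_pos hl, if_pos ⟨hn, hl⟩, Finset.card_insert_of_notMem]
        simp
      · rw [if_neg hl, if_neg (fun h => hl h.2), add_zero]
    · have e1 : Finset.Ico n₀ (l ++ [y]).length = ∅ := by
        apply Finset.Ico_eq_empty_of_le
        simp only [List.length_append, List.length_singleton]
        omega
      have e2 : Finset.Ico n₀ l.length = ∅ := Finset.Ico_eq_empty_of_le (by omega)
      simp only [c, e1, e2, hn, false_and, if_false]
      rfl
  have hclean : ∀ l y, clean (l ++ [y]) → clean l := by
    intro l y hl k hk hkl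
    have := hl k hk (by simp; omega)
    rwa [List.take_append_of_le_length hkl] at this
  have hclean' : ∀ l y, n₀ ≤ l.length → clean (l ++ [y]) → l ++ [y] ∉ D := by
    intro l y hn hl
    have := hl (l.length + 1) (by omega) (by simp)
    rwa [List.take_of_length_le (by simp)] at this
  have hg : ∀ m l, mean (nextState M l) (fun y => g m (l ++ [y])) ≤ g m l := by
    intro m l
    by_cases hl : clean l
    swap
    · refine mean_le fun y _ => ?_
      simp only [g]
      rw [if_neg (fun h' => hl (hclean l y h'))]
      exact bot_le
    by_cases hC : n₀ ≤ l.length ∧ l ∈ C ∧ c l < m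
    · obtain ⟨hn, hC, hcm⟩ := hC
      have hb : mean (nextState M l) (fun y => if l ++ [y] ∈ D then 0 else 1) ≤ 1 - δ := by
        refine ENNReal.le_sub_of_add_le_right ?_ ?_
        · refine ne_top_of_le_ne_top ENNReal.one_ne_top ((h l hC).trans (mean_le fun y _ => ?_))
          split_ifs <;> simp
        · refine (add_le_add_right (h l hC) _).trans ?_
          rw [← mean_add]
          refine mean_le fun y _ => ?_
          split_ifs <;> simp
      calc mean (nextState M l) (fun y => g m (l ++ [y]))
          ≤ mean (nextState M l)
              (fun y => (if l ++ [y] ∈ D then 0 else 1) * (1 - δ) ^ (m - c l - 1)) := by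
            refine mean_mono fun y _ => ?_
            simp only [g]
            split_ifs with h1 h2
            · exact absurd h2 (hclean' l y hn h1)
            · rw [hc, if_pos ⟨hn, hC⟩, one_mul, Nat.sub_sub]
            · simp
            · simp
        _ ≤ (1 - δ) * (1 - δ) ^ (m - c l - 1) := by
            rw [mean_mul_right]
            exact mul_le_mul_left hb _
        _ = g m l := by
            simp only [g, if_pos hl]
            rw [← pow_succ']
            congr 1
            omega
    · refine mean_le fun y _ => ?_
      simp only [g, if_pos hl]
      split_ifs
      · by_cases hC' : n₀ ≤ l.length ∧ l ∈ C
        · have : ¬ c l < m := fun h' => hC ⟨hC'.1, hC'.2, h'⟩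
          -- After `m` visits the truncated exponent is zero, so `g m` stays at 1 on clean
          -- histories.
          rw [show m - c l = 0 by omega, pow_zero]
          exact pow_le_one' h1δ _
        · rw [hc, if_neg hC', add_zero]
      · exact bot_le
  set Ev : Set (Run X) := {ρ | (∃ᶠ n in atTop, runPrefix ρ.states n ∈ C) ∧ ∀ n > n₀, runPrefix ρ.states n ∉ D}
    with hEv
  have hEvg : ∀ m, ∀ ρ ∈ Ev, ∀ᶠ n in atTop, 1 ≤ g m (runPrefix ρ.states n) := by
    rintro m ρ ⟨hC, hD⟩
    have hcl : ∀ n, clean (runPrefix ρ.states n) := by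
      intro n k hk hkn
      rw [length_runPrefix] at hkn
      rw [take_runPrefix ρ.states hkn]
      exact hD k hk
    have hstep : ∀ n, c (runPrefix ρ.states n) ≤ c (runPrefix ρ.states (n + 1)) := fun n => by
      rw [runPrefix_succ, hc]
      exact Nat.le_add_right _ _
    have hmono : Monotone fun n => c (runPrefix ρ.states n) := monotone_nat_of_le_succ hstep
    have hunb : ∃ n, m ≤ c (runPrefix ρ.states n) := by
      clear_value c
      clear hg hEv
      induction m with
      | zero => exact ⟨0, Nat.zero_le _⟩
      | succ m ih =>
        obtain ⟨n, hn⟩ := ih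
        obtain ⟨k, hk, hkC⟩ := (frequently_atTop.1 hC) (max n n₀)
        refine ⟨k + 1, ?_⟩
        rw [runPrefix_succ, hc, if_pos ⟨by rw [length_runPrefix]; omega, hkC⟩]
        have := hmono (show n ≤ k by omega)
        simp only at this
        omega
    obtain ⟨n₁, hn₁⟩ := hunb
    filter_upwards [eventually_ge_atTop n₁] with n hn
    simp only [g, if_pos (hcl n)]
    rw [Nat.sub_eq_zero_of_le (hn₁.trans (hmono hn)), pow_zero]
  have hμ : ∀ m, M.runMeasure Ev ≤ (1 - δ) ^ m := by
    intro m
    refine (measure_le_of_eventually_le M (g m) (hg m) Ev (ae_of_all _ fun ρ hρ => hEvg m ρ hρ)).trans ?_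
    simp only [g]
    split_ifs
    · simp [c]
    · exact bot_le
  have hlim : Tendsto (fun m : ℕ => (1 - δ) ^ m) atTop (nhds 0) :=
    ENNReal.tendsto_pow_atTop_nhds_zero_of_lt_one
      (ENNReal.sub_lt_self ENNReal.one_ne_top one_ne_zero hδ.ne')
  have hz : M.runMeasure Ev = 0 :=
    le_antisymm (ge_of_tendsto' hlim hμ) bot_le
  exact measure_eq_zero_iff_ae_notMem.1 hz

end Chain

end BoldMonitor

namespace BoldMonitor

/-! ## Candidates of finite paths -/

section Candidates

variable {V : Type*}

open Relation

theorem transGen_mono {r s : V → V → Prop} (hrs : ∀ v w, r v w → s v w) {v w : V}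
    (h : TransGen r v w) : TransGen s v w := by
  induction h with
  | single h => exact TransGen.single (hrs _ _ h)
  | tail _ h ih => exact ih.tail (hrs _ _ h)

theorem reflTransGen_mono {r s : V → V → Prop} (hrs : ∀ v w, r v w → s v w) {v w : V}
    (h : ReflTransGen r v w) : ReflTransGen s v w := by
  induction h with
  | refl => exact ReflTransGen.refl
  | tail _ h ih => exact ih.tail (hrs _ _ h)

theorem pathGraph_concat_adj_iff (p : List V) (y v w : V) :
    (pathGraph (p ++ [y])).Adj v w ↔ (pathGraph p).Adj v w ∨ (p.getLast? = some v ∧ w = y) := by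
  change [v, w] <:+: p ++ [y] ↔ [v, w] <:+: p ∨ _
  have h1 : [v, w] <:+: p ++ [y] ↔ [v, w] <:+ p ++ [y] ∨ [v, w] <:+: p := List.infix_concat_iff
  rw [h1, or_comm]
  refine or_congr_right ?_
  rw [List.getLast?_eq_some_iff]
  constructor
  · rintro ⟨a, ha⟩
    rw [show a ++ [v, w] = (a ++ [v]) ++ [w] by simp] at ha
    obtain ⟨h2, h3⟩ := List.append_inj' ha rfl
    exact ⟨⟨a, h2.symm⟩, by simpa using h3⟩
  · rintro ⟨⟨a, rfl⟩, rfl⟩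
    exact ⟨a, by simp⟩

theorem pathGraph_adj_mono {p q : List V} (h : p <:+: q) {v w : V}
    (hvw : (pathGraph p).Adj v w) : (pathGraph q).Adj v w :=
  List.IsInfix.trans hvw h

theorem pathGraph_adj_cons_cons (v w : V) (l : List V) : (pathGraph (v :: w :: l)).Adj v w :=
  (List.prefix_append [v, w] l).isInfix

/-- Along a path, every earlier state reaches every later one. -/
theorem transGen_pathGraph_cons (v w : V) (l : List V) (hw : w ∈ l) :
    TransGen (pathGraph (v :: l)).Adj v w := by
  induction l generalizing v with
  | nil => simp at hw
  | cons u l ih =>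
    have h1 : (pathGraph (v :: u :: l)).Adj v u := pathGraph_adj_cons_cons v u l
    rcases List.mem_cons.1 hw with rfl | hw
    · exact TransGen.single h1
    · exact TransGen.head h1 (transGen_mono (fun _ _ h => pathGraph_adj_mono
        (List.suffix_cons v _).isInfix h) (ih u hw))

theorem transGen_pathGraph_append (p l : List V) {v w : V} (hv : v ∈ p) (hw : w ∈ l) :
    TransGen (pathGraph (p ++ l)).Adj v w := by
  obtain ⟨a, b, rfl⟩ := List.append_of_mem hv
  have h := transGen_pathGraph_cons v w (b ++ l) (by simp [hw])
  refine transGen_mono (fun _ _ h => pathGraph_adj_mono ?_ h) h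
  exact ⟨a, [], by simp⟩

theorem reflTransGen_getLast {p : List V} {v x : V} (hv : v ∈ p) (hx : p.getLast? = some x) :
    ReflTransGen (pathGraph p).Adj v x := by
  obtain ⟨q, rfl⟩ := List.getLast?_eq_some_iff.1 hx
  rcases List.mem_append.1 hv with h | h
  · exact (transGen_pathGraph_append q [x] h (by simp)).to_reflTransGen
  · rw [List.mem_singleton.1 h]

/-- `K` is the support of a bottom strongly connected part of the graph of `p` that contains the
last state of `p`. -/
structure IsBottom (p : List V) (K : Set V) : Prop where
  last_mem : ∀ x, p.getLast? = some x → x ∈ K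
  nonempty : p ≠ []
  closed : ∀ v w, v ∈ K → (pathGraph p).Adj v w → w ∈ K
  connected : ∀ v ∈ K, ∀ w ∈ K, TransGen (pathGraph p).Adj v w

theorem mem_of_reflTransGen {r : V → V → Prop} {K : Set V} (hK : ∀ v w, v ∈ K → r v w → w ∈ K)
    {v w : V} (hv : v ∈ K) (h : ReflTransGen r v w) : w ∈ K := by
  induction h with
  | refl => exact hv
  | tail _ h ih => exact hK _ _ ih h

/-- Either set consists of exactly the states reachable from the last state of `p`. -/
theorem IsBottom.unique {p : List V} {K K' : Set V} (h : IsBottom p K) (h' : IsBottom p K') :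
    K = K' := by
  have key : ∀ {K K'}, IsBottom p K → IsBottom p K' → K ⊆ K' := by
    intro K K' h h' w hw
    obtain ⟨x, hx⟩ : ∃ x, p.getLast? = some x := ⟨p.getLast h.nonempty, List.getLast?_eq_some_getLast _⟩
    exact mem_of_reflTransGen h'.closed (h'.last_mem x hx)
      (h.connected x (h.last_mem x hx) w hw).to_reflTransGen
  exact (key h h').antisymm (key h' h)

theorem IsCandidate.isBottom {p : List V} {K : Set V} (h : IsCandidate p K) : IsBottom p K := by
  obtain ⟨κ, hκ, ⟨⟨-, ⟨⟨v, hv⟩, hsc⟩, -⟩, hbot⟩, rfl⟩ := h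
  have hne : κ ≠ [] := by
    rintro rfl
    exact absurd (show v ∈ ([] : List V) from hv) (by simp)
  refine ⟨fun x hx => ?_, ?_, fun v w hv h => hbot v w hv h, fun v hv w hw => ?_⟩
  · obtain ⟨a, rfl⟩ := hκ
    rw [List.getLast?_append_of_ne_nil _ hne] at hx
    exact List.mem_of_getLast? hx
  · rintro rfl
    exact hne (List.suffix_nil.1 hκ)
  · exact transGen_mono (fun _ _ h => pathGraph_adj_mono hκ.isInfix h) (hsc v hv w hw)

theorem DiGraph.ext_iff' {G H : DiGraph V} (h1 : G.verts = H.verts)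
    (h2 : ∀ v w, G.Adj v w ↔ H.Adj v w) : G = H := by
  cases G; cases H
  simp only [DiGraph.mk.injEq] at *
  exact ⟨h1, by funext v w; exact propext (h2 v w)⟩

/-- The suffix that starts at the first visit to `K` never leaves `K`, as `K` is closed. It contains
every state of `K` and every edge starting in `K`, since nothing of `K` occurs before it. -/
theorem IsBottom.isCandidate {p : List V} {K : Set V} (h : IsBottom p K) : IsCandidate p K := by
  classical
  obtain ⟨x, hx⟩ : ∃ x, p.getLast? = some x := ⟨p.getLast h.nonempty, List.getLast?_eq_some_getLast _⟩
  have hxK := h.last_mem x hx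
  have hxp : x ∈ p := List.mem_of_getLast? hx
  -- split `p` at the first state in `K`
  obtain ⟨a, κ, hp, ha, hκ⟩ : ∃ a κ, p = a ++ κ ∧ (∀ v ∈ a, v ∉ K) ∧ ∃ u κ', κ = u :: κ' ∧ u ∈ K := by
    clear hx h
    induction p with
    | nil => simp at hxp
    | cons u p ih =>
      by_cases hu : u ∈ K
      · exact ⟨[], u :: p, rfl, by simp, u, p, rfl, hu⟩
      · have : x ∈ p := by
          rcases List.mem_cons.1 hxp with rfl | h
          · exact absurd hxK hu
          · exact h
        obtain ⟨a, κ, rfl, ha, hκ⟩ := ih this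
        refine ⟨u :: a, κ, rfl, ?_, hκ⟩
        intro v hv
        rcases List.mem_cons.1 hv with rfl | hv
        · exact hu
        · exact ha v hv
  obtain ⟨u, κ', rfl, hu⟩ := hκ
  have hsuf : (u :: κ') <:+ p := ⟨a, hp.symm⟩
  have hsub : ∀ v ∈ u :: κ', v ∈ K := by
    intro v hv
    rcases List.mem_cons.1 hv with rfl | hv
    · exact hu
    · refine mem_of_reflTransGen h.closed hu (transGen_mono (fun _ _ h => pathGraph_adj_mono
        hsuf.isInfix h) (transGen_pathGraph_cons u v κ' hv)).to_reflTransGen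
  have hmem : ∀ v ∈ K, v ∈ u :: κ' := by
    intro v hv
    have : v ∈ p := by
      obtain ⟨w, hw, -⟩ := (TransGen.head'_iff).1 (h.connected v hv v hv)
      exact (pathGraph p).left_mem hw
    rw [hp, List.mem_append] at this
    exact this.resolve_left fun hva => ha v hva hv
  have hsupp : support (u :: κ') = K := Set.ext fun v => ⟨hsub v, hmem v⟩
  have hadj : ∀ v w, v ∈ K → (pathGraph p).Adj v w → (pathGraph (u :: κ')).Adj v w := by
    intro v w hv hvw
    obtain ⟨s, t, hst⟩ : [v, w] <:+: p := hvw
    rw [List.append_assoc, hp] at hst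
    rcases List.append_eq_append_iff.1 hst with ⟨c, h1, h2⟩ | ⟨c, h1, h2⟩
    · cases c with
      | nil => exact ⟨[], t, by simpa using h2⟩
      | cons c₀ c =>
        have : c₀ = v := by simp at h2; exact h2.1.symm
        subst this
        exact absurd hv (ha c₀ (by simp [h1]))
    · exact ⟨c, t, by rw [List.append_assoc]; exact h2.symm⟩
  have hconn : ∀ v ∈ K, ∀ w, TransGen (pathGraph p).Adj v w →
      w ∈ K ∧ TransGen (pathGraph (u :: κ')).Adj v w := by
    intro v hv w hvw
    induction hvw with
    | single hvw => exact ⟨h.closed _ _ hv hvw, TransGen.single (hadj _ _ hv hvw)⟩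
    | tail _ hbc ih => exact ⟨h.closed _ _ ih.1 hbc, ih.2.tail (hadj _ _ ih.1 hbc)⟩
  refine ⟨u :: κ', hsuf, ⟨⟨⟨?_, ?_⟩, ⟨⟨u, by simp [pathGraph, support]⟩, ?_⟩, ?_⟩, ?_⟩, hsupp⟩
  · exact fun v hv => hsuf.subset hv
  · exact fun v w h => pathGraph_adj_mono hsuf.isInfix h
  · exact fun v hv w hw => (hconn v (hsub v hv) w (h.connected v (hsub v hv) w (hsub w hw))).2
  -- Maximality: a strongly connected graph containing `u` only has states reachable from `u`, and
  -- these lie in `K`.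
  · intro H h1 h2 h3
    have hHK : ∀ v ∈ H.verts, v ∈ K := by
      intro v hv
      have h4 := h3.2 u (h1.1 (by simp [pathGraph, support])) v hv
      exact mem_of_reflTransGen h.closed hu (transGen_mono (fun _ _ h => h2.2 _ _ h) h4).to_reflTransGen
    refine DiGraph.ext_iff' (Set.Subset.antisymm (fun v hv => hmem v (hHK v hv)) h1.1) ?_
    exact fun v w => ⟨fun hvw => hadj v w (hHK v (H.left_mem hvw)) (h2.2 _ _ hvw), h1.2 v w⟩
  · exact fun v w hv hvw => hmem w (h.closed v w (hsub v hv) hvw)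

/-- Characterization of the candidate. -/
theorem candidate_eq_some_iff {p : List V} {K : Set V} : candidate p = some K ↔ IsBottom p K := by
  unfold candidate
  constructor
  · intro h
    split_ifs at h with hC
    · rw [← Option.some.inj h]
      exact hC.choose_spec.isBottom
  · intro h
    have hC : ∃ C, IsCandidate p C := ⟨K, h.isCandidate⟩
    rw [dif_pos hC]
    exact congrArg some (hC.choose_spec.isBottom.unique h)

@[simp] theorem candidate_nil : candidate ([] : List V) = none := by
  cases h : candidate ([] : List V) with
  | none => rfl
  | some K => exact absurd rfl (candidate_eq_some_iff.1 h).nonempty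

/-- A candidate persists while the path stays in it. -/
theorem candidate_concat_of_mem {p : List V} {K : Set V} (h : candidate p = some K) {y : V}
    (hy : y ∈ K) : candidate (p ++ [y]) = some K := by
  rw [candidate_eq_some_iff] at h ⊢
  refine ⟨fun x hx => ?_, by simp, fun v w hv hvw => ?_, fun v hv w hw => ?_⟩
  · simp at hx
    exact hx ▸ hy
  · rcases (pathGraph_concat_adj_iff p y v w).1 hvw with hvw | ⟨-, rfl⟩
    · exact h.closed v w hv hvw
    · exact hy
  · exact transGen_mono (fun _ _ h => pathGraph_adj_mono (List.prefix_append p [y]).isInfix h)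
      (h.connected v hv w hw)

/-- Between two times with the same candidate, the path stays in the candidate. -/
theorem mem_of_candidate_eq {p l : List V} {K : Set V} (h : candidate p = some K)
    (h' : candidate (p ++ l) = some K) {y : V} (hy : y ∈ l) : y ∈ K := by
  rw [candidate_eq_some_iff] at h h'
  obtain ⟨x, hx⟩ : ∃ x, p.getLast? = some x := ⟨p.getLast h.nonempty, List.getLast?_eq_some_getLast _⟩
  exact mem_of_reflTransGen h'.closed (h.last_mem x hx)
    (transGen_pathGraph_append p l (List.mem_of_getLast? hx) hy).to_reflTransGen

theorem candidate_append_of_subset {p l : List V} {K : Set V} (h : candidate p = some K)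
    (hl : ∀ y ∈ l, y ∈ K) : candidate (p ++ l) = some K := by
  induction l using List.reverseRecOn with
  | nil => simpa using h
  | append_singleton l y ih =>
    rw [← List.append_assoc]
    exact candidate_concat_of_mem (ih fun z hz => hl z (by simp [hz])) (hl y (by simp))

/-- The last state of a path with a candidate has occurred before. -/
theorem mem_of_candidate_concat {p : List V} {y : V} {K : Set V}
    (h : candidate (p ++ [y]) = some K) : y ∈ p := by
  rw [candidate_eq_some_iff] at h
  have hy : y ∈ K := h.last_mem y (by simp)
  -- A cycle through `y` needs an edge out of `y`. Either it was traversed within `p`, or it is the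
  -- last step, which then starts at `y`.
  obtain ⟨w, hw, -⟩ := (TransGen.head'_iff).1 (h.connected y hy y hy)
  rcases (pathGraph_concat_adj_iff p y y w).1 hw with hw | ⟨h, -⟩
  · exact (pathGraph p).left_mem hw
  · exact List.mem_of_getLast? h

/-! ### The candidate counter -/

/-- The state of the monitor's candidate register and counter after executing `p`. -/
noncomputable def monitorState (p : List V) : Option (Set V) × ℕ :=
  p.inits.foldl updateCandidate (none, 0)

theorem candidateIndex_eq (p : List V) : candidateIndex p = (monitorState p).2 := rfl

theorem monitorState_nil : monitorState ([] : List V) = (none, 0) := by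
  simp [monitorState, updateCandidate]

theorem monitorState_concat (p : List V) (y : V) :
    monitorState (p ++ [y]) = updateCandidate (monitorState p) (p ++ [y]) := by
  simp [monitorState, List.inits_append]

theorem monitorState_fst_of_candidate {p : List V} {K : Set V} (h : candidate p = some K) :
    (monitorState p).1 = some K := by
  induction p using List.reverseRecOn with
  | nil => simp at h
  | append_singleton p y _ =>
    rw [monitorState_concat, updateCandidate]
    split_ifs with h1
    · exact h
    · rw [h] at h1
      simp only [ne_eq, reduceCtorEq, not_false_eq_true, true_and, not_not] at h1
      exact h1.symm

/-- The register keeps its value while there is no candidate, so it may be outdated; it still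
records the candidate of some earlier prefix. -/
theorem exists_prefix_of_monitorState {p : List V} {K : Set V} (h : (monitorState p).1 = some K) :
    ∃ q l, p = q ++ l ∧ candidate q = some K := by
  induction p using List.reverseRecOn with
  | nil => simp [monitorState_nil] at h
  | append_singleton p y ih =>
    rw [monitorState_concat, updateCandidate] at h
    split_ifs at h with h1
    · exact ⟨p ++ [y], [], by simp, h⟩
    · obtain ⟨q, l, rfl, hq⟩ := ih h
      exact ⟨q, l ++ [y], by simp, hq⟩

theorem candidateIndex_nil : candidateIndex ([] : List V) = 0 := by
  simp [candidateIndex_eq, monitorState_nil]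

theorem candidateIndex_concat_of_mem {p : List V} {K : Set V} (h : candidate p = some K) {y : V}
    (hy : y ∈ K) : candidateIndex (p ++ [y]) = candidateIndex p := by
  rw [candidateIndex_eq, monitorState_concat, updateCandidate, if_neg, candidateIndex_eq]
  rw [candidate_concat_of_mem h hy, monitorState_fst_of_candidate h]
  simp

theorem candidateIndex_concat_of_none {p : List V} {y : V} (h : candidate (p ++ [y]) = none) :
    candidateIndex (p ++ [y]) = candidateIndex p := by
  rw [candidateIndex_eq, monitorState_concat, updateCandidate, if_neg, candidateIndex_eq]
  simp [h]

/-- The counter compares with the register rather than with the candidate of `p`. If the register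
already held `K`, then `K` was the candidate of a prefix and the path has not left `K` since, so `K`
would be the candidate of `p`. -/
theorem candidateIndex_concat_of_ne {p : List V} {y : V} {K : Set V}
    (h : candidate (p ++ [y]) = some K) (hp : candidate p ≠ some K) :
    candidateIndex (p ++ [y]) = candidateIndex p + 1 := by
  rw [candidateIndex_eq, monitorState_concat, updateCandidate, if_pos, candidateIndex_eq]
  refine ⟨by simp [h], fun h' => hp ?_⟩
  rw [h] at h'
  obtain ⟨q, l, rfl, hq⟩ := exists_prefix_of_monitorState h'.symm
  rw [List.append_assoc] at h
  exact candidate_append_of_subset hq fun z hz => mem_of_candidate_eq hq h (by simp [hz])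

/-! ### Birth and strength -/

theorem birth_le {p : List V} (hp : p ≠ []) : birth p ≤ p.length - 1 := by
  have hl := List.length_pos_of_ne_nil hp
  refine Nat.sInf_le ⟨by omega, ?_⟩
  rw [Nat.sub_add_cancel hl, List.take_length]

theorem birth_lt {p : List V} (hp : p ≠ []) : birth p < p.length := by
  have := birth_le hp
  have hl := List.length_pos_of_ne_nil hp
  omega

theorem birth_concat_of_mem {p : List V} {K : Set V} (h : candidate p = some K) {y : V}
    (hy : y ∈ K) : birth (p ++ [y]) = birth p := by
  have hne := (candidate_eq_some_iff.1 h).nonempty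
  have hl := List.length_pos_of_ne_nil hne
  have h' := candidate_concat_of_mem h hy
  unfold birth
  rw [h, h']
  set A := {b | b < (p ++ [y]).length ∧ candidate ((p ++ [y]).take (b + 1)) = some K} with hA
  set B := {b | b < p.length ∧ candidate (p.take (b + 1)) = some K} with hB
  have hBA : B ⊆ A := by
    rintro b ⟨hb, hc⟩
    refine ⟨by simp; omega, ?_⟩
    rwa [List.take_append_of_le_length (by omega)]
  have hAB : ∀ b ∈ A, b < p.length → b ∈ B := by
    rintro b ⟨-, hc⟩ hb
    refine ⟨hb, ?_⟩
    rwa [List.take_append_of_le_length (by omega)] at hc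
  have hBne : B.Nonempty := ⟨p.length - 1, by omega, by
    rw [Nat.sub_add_cancel hl, List.take_length]; exact h⟩
  apply le_antisymm
  · exact Nat.sInf_le (hBA (Nat.sInf_mem hBne))
  · have hAm := Nat.sInf_mem (hBne.mono hBA)
    refine Nat.sInf_le (hAB _ hAm ?_)
    have h1 : sInf A ≤ sInf B := Nat.sInf_le (hBA (Nat.sInf_mem hBne))
    exact h1.trans_lt (Nat.sInf_mem hBne).1

/-- An earlier birth would mean that the path stayed in `K` from then on, making `K` the candidate
of `p` already. -/
theorem birth_concat_of_ne {p : List V} {y : V} {K : Set V}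
    (h : candidate (p ++ [y]) = some K) (hp : candidate p ≠ some K) :
    birth (p ++ [y]) = p.length := by
  apply le_antisymm
  · simpa using birth_le (p := p ++ [y]) (by simp)
  · refine le_csInf ⟨p.length, by simp, by rw [List.take_of_length_le (by simp)]⟩ ?_
    rintro b ⟨hb, hc⟩
    by_contra! hlt
    rw [List.take_append_of_le_length (by omega), h] at hc
    apply hp
    rw [← List.take_append_drop (b + 1) p] at h ⊢
    rw [List.append_assoc] at h
    exact candidate_append_of_subset hc fun z hz => mem_of_candidate_eq hc h (by simp [hz])

open Classical in
/-- The number of departures from `x` since the birth of the candidate of `p`. -/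
noncomputable def departures (x : V) (p : List V) : ℕ := (p.drop (birth p)).dropLast.count x

-- `dropLast` omits the current visit, which becomes a departure only when the next state is
-- appended.
open Classical in
theorem departures_concat_of_mem {p : List V} {K : Set V} (h : candidate p = some K) {y : V}
    (hy : y ∈ K) (x : V) :
    departures x (p ++ [y]) = departures x p + if p.getLast? = some x then 1 else 0 := by
  have hne := (candidate_eq_some_iff.1 h).nonempty
  have hb := birth_lt hne
  unfold departures
  rw [birth_concat_of_mem h hy, List.drop_append_of_le_length hb.le]
  have hd : p.drop (birth p) ≠ [] := by simp; omega
  have hlast : p.getLast? = (p.drop (birth p)).getLast? := by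
    conv_lhs => rw [← List.take_append_drop (birth p) p, List.getLast?_append_of_ne_nil _ hd]
  rw [hlast]
  obtain ⟨q, z, hq⟩ : ∃ q z, p.drop (birth p) = q ++ [z] :=
    ⟨_, _, (List.dropLast_append_getLast hd).symm⟩
  rw [hq]
  simp [List.count_singleton]

theorem departures_concat_of_ne {p : List V} {y : V} {K : Set V}
    (h : candidate (p ++ [y]) = some K) (hp : candidate p ≠ some K) (x : V) :
    departures x (p ++ [y]) = 0 := by
  unfold departures
  rw [birth_concat_of_ne h hp]
  simp

open Classical in
/-- The values of `k` over which the strength is the maximum are bounded. -/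
theorem bddAbove_strength {p : List V} (hp : p ≠ []) (C : Set V) :
    BddAbove {k | (∀ v ∈ C, k ≤ (p.drop (birth p)).count v) ∧
        ∀ v, p.getLast? = some v → k + 1 ≤ (p.drop (birth p)).count v} := by
  refine ⟨(p.drop (birth p)).count (p.getLast hp), ?_⟩
  rintro k ⟨-, hk⟩
  have := hk _ (List.getLast?_eq_some_getLast hp)
  omega

/-- A candidate has been left at least `Str` times from each of its states. -/
theorem strength_le_departures {p : List V} {K : Set V} (h : candidate p = some K) {x : V}
    (hx : x ∈ K) : strength p ≤ departures x p := by
  have hne := (candidate_eq_some_iff.1 h).nonempty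
  have hb := birth_lt hne
  unfold strength
  rw [h]
  apply csSup_le'
  rintro k ⟨h1, h2⟩
  have hd : p.drop (birth p) ≠ [] := by simp; omega
  have hlast : p.getLast? = (p.drop (birth p)).getLast? := by
    conv_lhs => rw [← List.take_append_drop (birth p) p, List.getLast?_append_of_ne_nil _ hd]
  rw [hlast] at h2
  unfold departures
  obtain ⟨q, z, hq⟩ : ∃ q z, p.drop (birth p) = q ++ [z] :=
    ⟨_, _, (List.dropLast_append_getLast hd).symm⟩
  have h1 := h1 x hx
  have h2 := h2 z (by simp [hq])
  rw [hq] at h1 h2 ⊢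
  simp only [List.count_append, List.count_singleton, List.dropLast_concat] at h1 h2 ⊢
  by_cases hzx : z = x
  -- The extra occurrence that the strength demands of the last state pays for the visit that has
  -- not been left yet.
  · subst hzx
    simp at h2
    convert h2
  · simp [hzx] at h1
    convert h1

open Classical in
/-- A lower bound for the strength. -/
theorem le_strength {p : List V} {K : Set V} (h : candidate p = some K) {b m : ℕ}
    (hb : birth p ≤ b) (hm : ∀ v ∈ K, m + 1 ≤ (p.drop b).count v) : m ≤ strength p := by
  have hbot := candidate_eq_some_iff.1 h
  have hcount : ∀ v ∈ K, m + 1 ≤ (p.drop (birth p)).count v := by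
    intro v hv
    refine (hm v hv).trans (List.Sublist.count_le v ?_)
    obtain ⟨c, rfl⟩ := Nat.exists_eq_add_of_le hb
    rw [← List.drop_drop]
    exact List.drop_sublist _ _
  unfold strength
  rw [h]
  refine le_csSup (bddAbove_strength hbot.nonempty K) ⟨fun v hv => ?_, fun v hv => ?_⟩
  · exact (Nat.le_succ m).trans (hcount v hv)
  · exact hcount v (hbot.last_mem v hv)

end Candidates

end BoldMonitor

namespace BoldMonitor

open Relation

/-! ## Closed classes and absorption probabilities -/

section Absorption

variable {V : Type*} (N : MarkovChain V)

/-- The edges of the transition graph. -/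
def Edge (x y : V) : Prop := N.trans x y ≠ 0

/-- A set of states that is closed under transitions. -/
def IsClosedSet (K : Set V) : Prop := ∀ x ∈ K, ∀ y, Edge N x y → y ∈ K

/-- A closed communicating class of states. -/
structure IsClosedClass (K : Set V) : Prop where
  nonempty : K.Nonempty
  closed : IsClosedSet N K
  connected : ∀ x ∈ K, ∀ y ∈ K, ReflTransGen (Edge N) x y

variable {N}

theorem IsClosedSet.mem_of_reflTransGen {K : Set V} (hK : IsClosedSet N K) {x y : V} (hx : x ∈ K)
    (h : ReflTransGen (Edge N) x y) : y ∈ K :=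
  BoldMonitor.mem_of_reflTransGen (fun v w hv hvw => hK v hv w hvw) hx h

theorem IsClosedClass.eq_of_mem {K K' : Set V} (h : IsClosedClass N K) (h' : IsClosedClass N K')
    {x : V} (hx : x ∈ K) (hx' : x ∈ K') : K = K' :=
  Set.Subset.antisymm (fun _ hy => h'.closed.mem_of_reflTransGen hx' (h.connected x hx _ hy))
    (fun _ hy => h.closed.mem_of_reflTransGen hx (h'.connected x hx' _ hy))

open Classical in
/-- The probability to be in `G` after `n` steps. -/
noncomputable def absorbAt (N : MarkovChain V) (G : Set V) : ℕ → V → ℝ≥0∞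
  | 0, x => if x ∈ G then 1 else 0
  | n + 1, x => mean (N.trans x) (absorbAt N G n)

/-- The probability to reach the closed set `G`. -/
noncomputable def absorb (N : MarkovChain V) (G : Set V) (x : V) : ℝ≥0∞ := ⨆ n, absorbAt N G n x

theorem absorbAt_le_one (G : Set V) (n : ℕ) (x : V) : absorbAt N G n x ≤ 1 := by
  induction n generalizing x with
  | zero => unfold absorbAt; split_ifs <;> simp
  | succ n ih => exact mean_le fun y _ => ih y

theorem absorb_le_one (G : Set V) (x : V) : absorb N G x ≤ 1 :=
  iSup_le fun n => absorbAt_le_one G n x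

theorem absorb_ne_top (G : Set V) (x : V) : absorb N G x ≠ ∞ :=
  ne_top_of_le_ne_top ENNReal.one_ne_top (absorb_le_one G x)

/-- Since `G` is closed, being in `G` at time `n` implies being there at time `n + 1`. -/
theorem absorbAt_monotone {G : Set V} (hG : IsClosedSet N G) : Monotone (absorbAt N G) := by
  refine monotone_nat_of_le_succ fun n => ?_
  induction n with
  | zero =>
    intro x
    by_cases hx : x ∈ G
    · have : mean (N.trans x) (absorbAt N G 0) = mean (N.trans x) (fun _ => 1) :=
        mean_congr fun y hy => by simp [absorbAt, hG x hx y hy]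
      rw [absorbAt, absorbAt, this, mean_const, if_pos hx]
    · simp [absorbAt, hx]
  | succ n ih => exact fun x => mean_mono fun y _ => ih y

theorem absorb_of_mem {G : Set V} {x : V} (hx : x ∈ G) : absorb N G x = 1 := by
  refine le_antisymm (absorb_le_one G x) ?_
  refine le_trans ?_ (le_iSup (fun n => absorbAt N G n x) 0)
  simp [absorbAt, hx]

theorem absorb_eq_zero {G K : Set V} (hK : IsClosedSet N K) (hKG : ∀ x ∈ K, x ∉ G) {x : V}
    (hx : x ∈ K) : absorb N G x = 0 := by
  have : ∀ n, ∀ x ∈ K, absorbAt N G n x = 0 := by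
    intro n
    induction n with
    | zero => intro x hx; simp [absorbAt, hKG x hx]
    | succ n ih =>
      intro x hx
      exact le_antisymm (mean_le fun y hy => (ih y (hK x hx y hy)).le) bot_le
  simp [absorb, this _ x hx]

/-- Harmonicity, by first-step analysis and monotone convergence. -/
theorem mean_absorb [Finite V] {G : Set V} (hG : IsClosedSet N G) (x : V) :
    mean (N.trans x) (absorb N G) = absorb N G x := by
  have h1 : mean (N.trans x) (absorb N G) = ⨆ n, mean (N.trans x) (absorbAt N G n) :=
    mean_iSup (N.trans x) (absorbAt N G) (absorbAt_monotone hG)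
  rw [h1]
  apply le_antisymm
  · exact iSup_le fun n => le_iSup (fun n => absorbAt N G n x) (n + 1)
  · refine iSup_le fun n => ?_
    exact (absorbAt_monotone hG n.le_succ x).trans (le_iSup (fun n => mean (N.trans x) (absorbAt N G n)) n)

theorem exists_reachable_of_absorb_ne_zero {G : Set V} {x : V} (h : absorb N G x ≠ 0) :
    ∃ y ∈ G, ReflTransGen (Edge N) x y := by
  obtain ⟨n, hn⟩ : ∃ n, absorbAt N G n x ≠ 0 := by
    by_contra! h'
    exact h (by simp [absorb, h'])
  clear h
  induction n generalizing x with
  | zero =>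
    refine ⟨x, ?_, ReflTransGen.refl⟩
    by_contra hx
    simp [absorbAt, hx] at hn
  | succ n ih =>
    obtain ⟨y, hy, hyn⟩ : ∃ y, N.trans x y ≠ 0 ∧ absorbAt N G n y ≠ 0 := by
      by_contra! h'
      exact hn (le_antisymm (mean_le fun y hy => (h' y hy).le) bot_le)
    obtain ⟨z, hz, hyz⟩ := ih hyn
    exact ⟨z, hz, ReflTransGen.head hy hyz⟩

/-- Maximum principle: a strongly connected set that is not closed is left by some transition along
which the absorption probability does not decrease. -/
theorem exists_exit [Finite V] {G K : Set V} (hG : IsClosedSet N G) (hne : K.Nonempty)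
    (hconn : ∀ x ∈ K, ∀ y ∈ K, ReflTransGen (Edge N) x y) (hK : ¬ IsClosedSet N K) :
    ∃ x ∈ K, ∃ y, y ∉ K ∧ Edge N x y ∧ absorb N G x ≤ absorb N G y := by
  by_contra! hcon
  obtain ⟨x₀, hx₀, hmax⟩ := Set.exists_max_image K (absorb N G) (Set.toFinite K) hne
  -- If every exit strictly decreases the harmonic function, a point where it is maximal on `K` has
  -- all successors in `K` and with the same value. By connectivity this spreads to all of `K`, so
  -- `K` would be closed.
  have hstep : ∀ x ∈ K, absorb N G x = absorb N G x₀ → ∀ y, Edge N x y →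
      y ∈ K ∧ absorb N G y = absorb N G x₀ := by
    intro x hx hxm y hy
    have hle : ∀ y, N.trans x y ≠ 0 → absorb N G y ≤ absorb N G x₀ := by
      intro y hy
      by_cases hyK : y ∈ K
      · exact hmax y hyK
      · exact ((hcon x hx y hyK hy).trans_eq hxm).le
    have heq := eq_of_le_mean (absorb_ne_top G x₀) hle
      (by rw [mean_absorb hG, hxm]) hy
    refine ⟨?_, heq⟩
    by_contra hyK
    exact absurd (hcon x hx y hyK hy) (by rw [hxm, heq]; exact lt_irrefl _)
  have hall : ∀ y, ReflTransGen (Edge N) x₀ y → y ∈ K ∧ absorb N G y = absorb N G x₀ := by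
    intro y hy
    induction hy with
    | refl => exact ⟨hx₀, rfl⟩
    | tail _ h ih => exact hstep _ ih.1 ih.2 _ h
  exact hK fun x hx y hxy => (hall y ((hconn x₀ hx₀ x hx).tail hxy)).1

end Absorption

/-! ## Paths of positive probability -/

section PositivePaths

variable {V : Type*} {N : MarkovChain V}

/-- The finite paths of positive probability. -/
def IsPath (N : MarkovChain V) (p : List V) : Prop :=
  ∀ q y, q ++ [y] <+: p → nextState N q y ≠ 0

theorem isPath_nil : IsPath N [] := fun q y h => by simp at h

theorem isPath_concat_iff {p : List V} {y : V} :
    IsPath N (p ++ [y]) ↔ IsPath N p ∧ nextState N p y ≠ 0 := by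
  constructor
  · exact fun h => ⟨fun q z hq => h q z (hq.trans (List.prefix_append _ _)), h p y List.prefix_rfl⟩
  · rintro ⟨h, hy⟩ q z hq
    rcases List.prefix_concat_iff.1 hq with hq | hq
    · obtain ⟨rfl, h'⟩ := List.append_inj' hq rfl
      simp at h'
      exact h' ▸ hy
    · exact h q z hq

theorem IsPath.of_append {p l : List V} (h : IsPath N (p ++ l)) : IsPath N p :=
  fun q y hq => h q y (hq.trans (List.prefix_append _ _))

theorem nextState_of_getLast? {p : List V} {x : V} (h : p.getLast? = some x) :
    nextState N p = N.trans x := by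
  obtain ⟨q, rfl⟩ := List.getLast?_eq_some_iff.1 h
  exact nextState_concat N q x

theorem IsPath.edge_of_adj {p : List V} (h : IsPath N p) {v w : V} (hvw : (pathGraph p).Adj v w) :
    Edge N v w := by
  induction p using List.reverseRecOn with
  | nil => exact absurd ((pathGraph ([] : List V)).left_mem hvw) (by simp [pathGraph, support])
  | append_singleton p y ih =>
    obtain ⟨hp, hy⟩ := isPath_concat_iff.1 h
    rcases (pathGraph_concat_adj_iff p y v w).1 hvw with hvw | ⟨hv, rfl⟩
    · exact ih hp hvw
    · rwa [nextState_of_getLast? hv] at hy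

theorem IsPath.append_of_isChain {p l : List V} {x : V} (h : IsPath N (p ++ [x]))
    (hl : List.IsChain (Edge N) (x :: l)) : IsPath N (p ++ x :: l) := by
  induction l generalizing p x with
  | nil => exact h
  | cons y l ih =>
    rw [List.isChain_cons_cons] at hl
    have h1 : IsPath N ((p ++ [x]) ++ [y]) :=
      isPath_concat_iff.2 ⟨h, by rw [nextState_concat]; exact hl.1⟩
    simpa using ih h1 hl.2

/-- The states of a candidate communicate. -/
theorem IsPath.candidate_connected {p : List V} (h : IsPath N p) {K : Set V}
    (hK : candidate p = some K) : ∀ x ∈ K, ∀ y ∈ K, ReflTransGen (Edge N) x y := fun x hx y hy =>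
  (transGen_mono (fun _ _ hvw => h.edge_of_adj hvw)
    ((candidate_eq_some_iff.1 hK).connected x hx y hy)).to_reflTransGen

/-- A reachable state is reached by a path without repetitions. -/
theorem exists_nodup_chain {r : V → V → Prop} {x y : V} (h : ReflTransGen r x y) :
    ∃ l, (x :: l).Nodup ∧ List.IsChain r (x :: l) ∧ (x :: l).getLast? = some y := by
  induction h using ReflTransGen.head_induction_on with
  | refl => exact ⟨[], by simp, by simp, by simp⟩
  | head hab hbc ih =>
    rename_i a b
    obtain ⟨l, hn, hc, hl⟩ := ih
    by_cases ha : a ∈ b :: l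
    · obtain ⟨s, t, hst⟩ := List.append_of_mem ha
      rw [hst] at hn hc hl
      refine ⟨t, (List.nodup_append.1 hn).2.1, hc.right_of_append, ?_⟩
      rwa [List.getLast?_append_of_ne_nil _ (by simp)] at hl
    · refine ⟨b :: l, List.nodup_cons.2 ⟨ha, hn⟩, ?_, ?_⟩
      · rw [List.isChain_cons_cons]
        exact ⟨hab, hc⟩
      · rw [List.getLast?_cons_cons]
        exact hl

end PositivePaths

/-! ## Hitting probabilities of sets of finite paths -/

section Hitting

variable {V : Type*} (N : MarkovChain V)

open Classical in
/-- The probability that an extension by at most `n` states of the path has a prefix in `T`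
(prefixes of the given path itself are not considered). -/
noncomputable def hitWithin (T : Set (List V)) : ℕ → List V → ℝ≥0∞
  | 0, p => if p ∈ T then 1 else 0
  | n + 1, p => if p ∈ T then 1 else mean (nextState N p) (fun y => hitWithin T n (p ++ [y]))

/-- The probability that an extension of the path lies in `T`. -/
noncomputable def hitProb (T : Set (List V)) (p : List V) : ℝ≥0∞ := ⨆ n, hitWithin N T n p

variable {N}

theorem hitWithin_of_mem {T : Set (List V)} {p : List V} (hp : p ∈ T) (n : ℕ) :
    hitWithin N T n p = 1 := by
  cases n <;> simp [hitWithin, hp]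

theorem hitWithin_le_one (T : Set (List V)) (n : ℕ) (p : List V) : hitWithin N T n p ≤ 1 := by
  induction n generalizing p with
  | zero => unfold hitWithin; split_ifs <;> simp
  | succ n ih =>
    unfold hitWithin
    split_ifs
    · exact le_rfl
    · exact mean_le fun y _ => ih _

theorem hitProb_le_one (T : Set (List V)) (p : List V) : hitProb N T p ≤ 1 :=
  iSup_le fun n => hitWithin_le_one T n p

theorem hitWithin_le_succ (T : Set (List V)) (n : ℕ) (p : List V) :
    hitWithin N T n p ≤ hitWithin N T (n + 1) p := by
  by_cases hp : p ∈ T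
  · rw [hitWithin_of_mem hp, hitWithin_of_mem hp]
  · induction n generalizing p with
    | zero => simp [hitWithin, hp]
    | succ n ih =>
      rw [hitWithin, hitWithin, if_neg hp, if_neg hp]
      refine mean_mono fun y _ => ?_
      by_cases hy : p ++ [y] ∈ T
      · rw [hitWithin_of_mem hy, hitWithin_of_mem hy]
      · exact ih _ hy

theorem hitProb_of_mem {T : Set (List V)} {p : List V} (hp : p ∈ T) : hitProb N T p = 1 := by
  simp [hitProb, hitWithin_of_mem hp]

/-- First-step analysis, with the limit over the horizon exchanged with a finite sum. -/
theorem hitProb_of_notMem [Finite V] {T : Set (List V)} {p : List V} (hp : p ∉ T) :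
    hitProb N T p = mean (nextState N p) (fun y => hitProb N T (p ++ [y])) := by
  have h1 : mean (nextState N p) (fun y => hitProb N T (p ++ [y])) =
      ⨆ n, mean (nextState N p) (fun y => hitWithin N T n (p ++ [y])) :=
    mean_iSup (nextState N p) (fun n y => hitWithin N T n (p ++ [y]))
      (monotone_nat_of_le_succ fun n y => hitWithin_le_succ T n _)
  have h2 : ∀ n, mean (nextState N p) (fun y => hitWithin N T n (p ++ [y])) =
      hitWithin N T (n + 1) p := fun n => by rw [hitWithin, if_neg hp]
  rw [h1]
  simp only [h2]
  exact le_antisymm (iSup_le fun n => (hitWithin_le_succ T n p).trans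
    (le_iSup (fun n => hitWithin N T (n + 1) p) n))
    (iSup_le fun n => le_iSup (fun n => hitWithin N T n p) (n + 1))

theorem hitProb_mono [Finite V] {T T' : Set (List V)} (h : T ⊆ T') (p : List V) :
    hitProb N T p ≤ hitProb N T' p := by
  refine iSup_mono fun n => ?_
  induction n generalizing p with
  | zero =>
    unfold hitWithin
    split_ifs with h1 h2
    · exact le_rfl
    · exact absurd (h h1) h2
    · simp
    · exact le_rfl
  | succ n ih =>
    by_cases h2 : p ∈ T'
    · rw [hitWithin_of_mem h2]
      exact hitWithin_le_one _ _ _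
    · rw [hitWithin, hitWithin, if_neg h2, if_neg (fun h1 => h2 (h h1))]
      exact mean_mono fun y _ => ih _

/-- A comparison principle for hitting probabilities. -/
theorem hitProb_add_le {T : Set (List V)} (I : List V → Prop)
    (hI : ∀ p y, I p → nextState N p y ≠ 0 → p ∉ T → I (p ++ [y])) (g F : List V → ℝ≥0∞)
    (hg1 : ∀ p, g p ≤ 1)
    (hg : ∀ p, I p → g p ≤ mean (nextState N p) (fun y => g (p ++ [y])))
    (hF : ∀ p, I p → p ∉ T → mean (nextState N p) (fun y => F (p ++ [y])) ≤ F p)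
    (hT : ∀ p, I p → p ∈ T → g p ≤ F p) (p : List V) (hp : I p) :
    hitProb N T p + g p ≤ 1 + F p := by
  rw [hitProb, ENNReal.iSup_add]
  refine iSup_le fun n => ?_
  -- In essence `1 - g + F` is superharmonic off `T` and at least 1 on `T`, so it dominates the
  -- hitting probability. The additive form avoids truncated subtraction.
  induction n generalizing p with
  | zero =>
    unfold hitWithin
    split_ifs with h
    · exact add_le_add_right (hT p hp h) _
    · rw [zero_add]
      exact (hg1 p).trans le_self_add
  | succ n ih =>
    by_cases h : p ∈ T
    · rw [hitWithin_of_mem h]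
      exact add_le_add_right (hT p hp h) _
    · rw [hitWithin, if_neg h]
      calc mean (nextState N p) (fun y => hitWithin N T n (p ++ [y])) + g p
          ≤ mean (nextState N p) (fun y => hitWithin N T n (p ++ [y])) +
              mean (nextState N p) (fun y => g (p ++ [y])) := add_le_add_right (hg p hp) _
        _ ≤ mean (nextState N p) (fun y => 1 + F (p ++ [y])) := by
            rw [← mean_add]
            exact mean_mono fun y hy => ih _ (hI p y hp hy h)
        _ ≤ 1 + F p := by
            rw [mean_add, mean_const]
            exact add_le_add_right (hF p hp h) _

/-- The comparison principle with `g = 1` and `F = 0`, applied to an invariant that excludes `T`. -/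
theorem hitProb_eq_zero {T : Set (List V)} (I : List V → Prop)
    (hI : ∀ p y, I p → nextState N p y ≠ 0 → I (p ++ [y])) (hT : ∀ p, I p → p ∉ T)
    {p : List V} (hp : I p) : hitProb N T p = 0 := by
  have h := hitProb_add_le (N := N) (T := T) I (fun p y h1 h2 _ => hI p y h1 h2) (fun _ => 1)
    (fun _ => 0) (fun _ => le_rfl) (fun p _ => (mean_const _ _).ge) (fun p _ _ => (mean_const _ _).le)
    (fun p h1 h2 => absurd h2 (hT p h1)) p hp
  have h' : hitProb N T p + 1 ≤ 0 + 1 := by simpa using h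
  exact le_antisymm ((ENNReal.add_le_add_iff_right ENNReal.one_ne_top).1 h') bot_le

/-- If `T` were hit almost surely from `p`, it would be hit almost surely from every possible
successor. -/
theorem hitProb_lt_one_of_concat [Finite V] {T : Set (List V)} {p : List V} {y : V} (hp : p ∉ T)
    (hy : nextState N p y ≠ 0) (h : hitProb N T (p ++ [y]) < 1) : hitProb N T p < 1 := by
  rw [hitProb_of_notMem hp]
  refine lt_of_le_of_ne (mean_le fun y _ => hitProb_le_one T _) fun heq => h.ne ?_
  exact eq_of_le_mean ENNReal.one_ne_top (fun y _ => hitProb_le_one T _) heq.ge hy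

theorem hitProb_lt_one_of_append [Finite V] {T : Set (List V)} {p : List V} (l : List V)
    (hp : p ∉ T) (hl : ∀ q y, q ++ [y] <+: l → p ++ q ++ [y] ∉ T) (hpath : IsPath N (p ++ l))
    (h : hitProb N T (p ++ l) < 1) : hitProb N T p < 1 := by
  induction l using List.reverseRecOn with
  | nil => simpa using h
  | append_singleton l y ih =>
    rw [← List.append_assoc] at h hpath
    refine ih (fun q z hq => hl q z (hq.trans (List.prefix_append _ _))) hpath.of_append ?_
    refine hitProb_lt_one_of_concat ?_ (isPath_concat_iff.1 hpath).2 h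
    rcases List.eq_nil_or_concat l with rfl | ⟨q, z, rfl⟩
    · simpa using hp
    · rw [List.concat_eq_append, ← List.append_assoc]
      exact hl q z (by simp)

end Hitting

/-! ## Exploring a closed class without a bad candidate -/

section Exploration

variable {V : Type*} {N : MarkovChain V} {B : Set V} {f : V} {T : Set (List V)}

/-- As `y` occurs in `s` and `s` ends in `f`, the path graph leads from `y` to `f`; the candidate
contains `y` and is closed in that graph. -/
theorem candidate_of_revisit {s e : List V} {y : V} (hs : s.getLast? = some f) (hy : y ∈ s)
    {K : Set V} (hK : candidate (s ++ e ++ [y]) = some K) : f ∈ K := by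
  have hb := candidate_eq_some_iff.1 hK
  have h1 := reflTransGen_getLast hy hs
  refine mem_of_reflTransGen hb.closed (hb.last_mem y (by simp)) (reflTransGen_mono (fun v w h => ?_) h1)
  exact pathGraph_adj_mono ⟨[], e ++ [y], by simp⟩ h

/-- A path ending in a state seen for the first time has no candidate. One ending in a state of `s`
has at most candidates that contain `f`, and these lie in the closed set `B` because their states
communicate. -/
theorem notMem_of_revisit_or_fresh (hB : IsClosedSet N B) (hf : f ∈ B)
    (hT : ∀ p ∈ T, ∃ K, candidate p = some K ∧ ¬ (f ∈ K ∧ K ⊆ B)) {s e : List V} {y : V}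
    (hs : s = [] ∨ s.getLast? = some f) (hp : IsPath N (s ++ e ++ [y]))
    (hy : y ∈ s ∨ y ∉ s ++ e) : s ++ e ++ [y] ∉ T := by
  intro hmem
  obtain ⟨K, hK, hbad⟩ := hT _ hmem
  rcases hy with hy | hy
  · rcases hs with rfl | hs
    · simp at hy
    · have hfK := candidate_of_revisit hs hy hK
      exact hbad ⟨hfK, fun z hz =>
        hB.mem_of_reflTransGen hf (hp.candidate_connected hK f hfK z hz)⟩
  · exact hy (mem_of_candidate_concat hK)

theorem exists_first_exit {s : List V} (hs : s.getLast? = some f) (hp : IsPath N s) {b : V}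
    (hb : b ∉ s) (h : ReflTransGen (Edge N) f b) :
    ∃ e y, (∀ z ∈ e, z ∈ s) ∧ y ∉ s ∧ IsPath N (s ++ e ++ [y]) := by
  have key : (∃ e y, (∀ z ∈ e, z ∈ s) ∧ y ∉ s ∧ IsPath N (s ++ e ++ [y])) ∨
      ∃ e, (∀ z ∈ e, z ∈ s) ∧ IsPath N (s ++ e) ∧ (s ++ e).getLast? = some b := by
    clear hb
    induction h with
    | refl => exact Or.inr ⟨[], by simp, by simpa using hp, by simpa using hs⟩
    | tail hfb hbc ih =>
      rename_i b c
      rcases ih with ih | ⟨e, he, hpath, hlast⟩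
      · exact Or.inl ih
      · have hpath' : IsPath N (s ++ e ++ [c]) :=
          isPath_concat_iff.2 ⟨hpath, by rw [nextState_of_getLast? hlast]; exact hbc⟩
        by_cases hc : c ∈ s
        · refine Or.inr ⟨e ++ [c], ?_, by simpa using hpath', by simp [← List.append_assoc]⟩
          intro z hz
          rcases List.mem_append.1 hz with hz | hz
          · exact he z hz
          · rw [List.mem_singleton.1 hz]; exact hc
        · exact Or.inl ⟨e, c, he, hc, hpath'⟩
  rcases key with h | ⟨e, he, -, hlast⟩
  · exact h
  · refine absurd ?_ hb
    rcases List.mem_append.1 (List.mem_of_getLast? hlast) with h | h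
    · exact h
    · exact he b h

/-- Induction on the number of unvisited states of `B`: walk through known states to a new one, then
return to `f` without repetition. Every state on the way is a revisit of `s` or fresh, so `T` is
avoided. -/
theorem hitProb_lt_one_of_last [Finite V] (hB : IsClosedClass N B) (hf : f ∈ B)
    (hT : ∀ p ∈ T, ∃ K, candidate p = some K ∧ ¬ (f ∈ K ∧ K ⊆ B)) (s : List V)
    (hs : s.getLast? = some f) (hp : IsPath N s) : hitProb N T s < 1 := by
  have hsT : ∀ s : List V, s.getLast? = some f → IsPath N s → s ∉ T := by
    intro s hs hp hmem
    obtain ⟨K, hK, hbad⟩ := hT _ hmem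
    have hfK := (candidate_eq_some_iff.1 hK).last_mem f hs
    exact hbad ⟨hfK, fun z hz =>
      hB.closed.mem_of_reflTransGen hf (hp.candidate_connected hK f hfK z hz)⟩
  induction hn : (B \ {x | x ∈ s}).ncard using Nat.strong_induction_on generalizing s with
  | _ n ih =>
    by_cases hcov : ∀ b ∈ B, b ∈ s
    -- Once `B` is fully visited, every later state is a revisit of `s`, so `T` is never hit.
    · rw [hitProb_eq_zero (N := N) (T := T)
        (fun l => IsPath N l ∧ ∃ e, l = s ++ e ∧ ∀ z ∈ e, z ∈ B)]
      · exact zero_lt_one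
      · rintro l y ⟨hl, e, rfl, he⟩ hy
        refine ⟨isPath_concat_iff.2 ⟨hl, hy⟩, e ++ [y], by simp, ?_⟩
        intro z hz
        rcases List.mem_append.1 hz with hz | hz
        · exact he z hz
        · rw [List.mem_singleton.1 hz]
          obtain ⟨x, hx, hxB⟩ : ∃ x, (s ++ e).getLast? = some x ∧ x ∈ B := by
            rcases List.eq_nil_or_concat e with rfl | ⟨e', x, rfl⟩
            · exact ⟨f, by simpa using hs, hf⟩
            · exact ⟨x, by simp [← List.append_assoc], he x (by simp)⟩
          rw [nextState_of_getLast? hx] at hy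
          exact hB.closed x hxB y hy
      · rintro l ⟨hl, e, rfl, he⟩
        rcases List.eq_nil_or_concat e with rfl | ⟨e', x, rfl⟩
        · simpa using hsT s hs hp
        · rw [List.concat_eq_append, ← List.append_assoc] at hl ⊢
          exact notMem_of_revisit_or_fresh hB.closed hf hT (Or.inr hs) hl
            (Or.inl (hcov x (he x (by simp))))
      · exact ⟨hp, [], by simp, by simp⟩
    · push Not at hcov
      obtain ⟨b, hbB, hbs⟩ := hcov
      obtain ⟨e, y, he, hys, hpath⟩ := exists_first_exit hs hp hbs (hB.connected f hf b hbB)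
      have hyB : y ∈ B := by
        obtain ⟨x, hx⟩ : ∃ x, (s ++ e).getLast? = some x := by
          cases h : (s ++ e).getLast? with
          | none =>
            rw [List.getLast?_eq_none_iff, List.append_eq_nil_iff] at h
            simp [h.1] at hs
          | some x => exact ⟨x, rfl⟩
        have hxs : x ∈ s := by
          rcases List.mem_append.1 (List.mem_of_getLast? hx) with h | h
          · exact h
          · exact he x h
        have h1 : TransGen (pathGraph (s ++ e ++ [y])).Adj f y := by
          have := transGen_pathGraph_append s (e ++ [y]) (List.mem_of_getLast? hs)
            (show y ∈ e ++ [y] by simp)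
          simpa using this
        exact hB.closed.mem_of_reflTransGen hf
          (transGen_mono (fun _ _ h => hpath.edge_of_adj h) h1).to_reflTransGen
      obtain ⟨h, hnd, hch, hl⟩ := exists_nodup_chain (hB.connected y hyB f hf)
      have hpath2 : IsPath N (s ++ e ++ y :: h) := hpath.append_of_isChain hch
      have hpath3 : IsPath N (s ++ (e ++ y :: h)) := by simpa using hpath2
      have hlast : (s ++ (e ++ y :: h)).getLast? = some f := by
        rw [← List.append_assoc, List.getLast?_append_of_ne_nil _ (by simp)]
        exact hl
      refine hitProb_lt_one_of_append (e ++ y :: h) (hsT s hs hp) ?_ hpath3 ?_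
      · intro q z hq
        have hpq : IsPath N (s ++ q ++ [z]) := by
          obtain ⟨t, ht⟩ := hq
          rw [← ht] at hpath3
          refine IsPath.of_append (l := t) ?_
          simpa using hpath3
        refine notMem_of_revisit_or_fresh hB.closed hf hT (Or.inr hs) hpq ?_
        by_cases hz : z ∈ s
        · exact Or.inl hz
        · refine Or.inr fun hzq => ?_
          have hzq : z ∈ q := (List.mem_append.1 hzq).resolve_left hz
          obtain ⟨t, ht⟩ := hq
          have ht' : q ++ (z :: t) = e ++ y :: h := by simpa using ht
          have hze : z ∉ e := fun hze => hz (he z hze)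
          -- A state outside `s` cannot lie in `e`, so it lies in the return path `y :: h`, where it
          -- occurs only once.
          rcases List.append_eq_append_iff.1 ht' with ⟨c, h1, h2⟩ | ⟨c, h1, h2⟩
          · exact hze (by rw [h1]; simp [hzq])
          · rw [h1] at hzq
            have hzc : z ∈ c := (List.mem_append.1 hzq).resolve_left hze
            rw [h2, List.nodup_append] at hnd
            exact hnd.2.2 z hzc z (by simp) rfl
      · refine ih _ ?_ _ hlast hpath3 rfl
        rw [← hn]
        refine Set.ncard_lt_ncard ⟨?_, fun hsub => ?_⟩ (Set.toFinite _)
        · exact fun z hz => ⟨hz.1, fun hzs => hz.2 (by simp [show z ∈ s from hzs])⟩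
        · exact (hsub (show y ∈ B \ {x | x ∈ s} from ⟨hyB, hys⟩)).2 (by simp)

/-- If the closed class `B` is reachable, then with positive probability every candidate is
contained in `B` and contains the given state of `B`. -/
theorem hitProb_nil_lt_one [Finite V] (hB : IsClosedClass N B) (hf : f ∈ B)
    (hT : ∀ p ∈ T, ∃ K, candidate p = some K ∧ ¬ (f ∈ K ∧ K ⊆ B)) {x : V} (hx : N.init x ≠ 0)
    (hxf : ReflTransGen (Edge N) x f) : hitProb N T [] < 1 := by
  obtain ⟨h, hnd, hch, hl⟩ := exists_nodup_chain hxf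
  have hx' : IsPath N ([] ++ [x]) := isPath_concat_iff.2 ⟨isPath_nil, hx⟩
  have hpath : IsPath N ([] ++ x :: h) := hx'.append_of_isChain hch
  -- A path to `f` without repetitions has no candidates on the way.
  refine hitProb_lt_one_of_append (x :: h) ?_ ?_ hpath
    (hitProb_lt_one_of_last hB hf hT _ (by simpa using hl) hpath)
  · intro hmem
    obtain ⟨K, hK, -⟩ := hT _ hmem
    simp at hK
  · rintro q z ⟨t, ht⟩
    refine notMem_of_revisit_or_fresh hB.closed hf hT (Or.inl rfl) ?_ ?_
    · rw [← ht] at hpath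
      exact IsPath.of_append (l := t) (by simpa using hpath)
    · refine Or.inr fun hzq => ?_
      rw [← ht, List.nodup_append, List.nodup_append] at hnd
      exact hnd.1.2.2 z (by simpa using hzq) z (by simp) rfl

end Exploration

end BoldMonitor

namespace BoldMonitor

open Relation

/-! ## Resetting on candidates that are not closed -/

section FalseCandidates

variable {V : Type*} {N : MarkovChain V} {G : Set V}

/-- The probability to reach `G` after the path `p`. -/
noncomputable def absorbAfter (N : MarkovChain V) (G : Set V) (p : List V) : ℝ≥0∞ :=
  mean (nextState N p) (absorb N G)

theorem absorbAfter_le_one (p : List V) : absorbAfter N G p ≤ 1 :=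
  mean_le fun y _ => absorb_le_one G y

theorem absorbAfter_of_getLast? [Finite V] (hG : IsClosedSet N G) {p : List V} {x : V}
    (hx : p.getLast? = some x) : absorbAfter N G p = absorb N G x := by
  rw [absorbAfter, nextState_of_getLast? hx, mean_absorb hG]

theorem absorbAfter_concat [Finite V] (hG : IsClosedSet N G) (p : List V) (y : V) :
    absorbAfter N G (p ++ [y]) = absorb N G y :=
  absorbAfter_of_getLast? hG (by simp)

open Classical in
/-- A bound for the probability that, after the path `p`, the chain reaches `G` and moreover the
current candidate, if it is not closed, reaches strength `k i`, where `i` is the candidate counter.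
Here `ex K` is a state from which `K` can be left, and `β` bounds the probability not to do so. -/
noncomputable def stayBound (N : MarkovChain V) (G : Set V) (β : ℝ≥0∞) (k : ℕ → ℕ)
    (ex : Set V → V) (p : List V) : ℝ≥0∞ :=
  match candidate p with
  | none => 0
  | some K => if IsClosedSet N K then 0 else
      absorbAfter N G p * β ^ (k (candidateIndex p) - departures (ex K) p)

/-- A bound for the probability that, after the path `p`, the chain reaches `G` and moreover some
candidate that is not closed reaches its threshold `k i`. -/
noncomputable def falseBound (N : MarkovChain V) (G : Set V) (β : ℝ≥0∞) (k : ℕ → ℕ)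
    (ex : Set V → V) (c : ℕ → ℝ≥0∞) (p : List V) : ℝ≥0∞ :=
  absorbAfter N G p * c (candidateIndex p) + stayBound N G β k ex p

variable {β : ℝ≥0∞} {k : ℕ → ℕ} {ex : Set V → V} {c : ℕ → ℝ≥0∞}

theorem stayBound_of_closed {p : List V} {K : Set V} (h : candidate p = some K)
    (hK : IsClosedSet N K) : stayBound N G β k ex p = 0 := by
  simp [stayBound, h, hK]

theorem stayBound_of_not_closed {p : List V} {K : Set V} (h : candidate p = some K)
    (hK : ¬ IsClosedSet N K) : stayBound N G β k ex p =
      absorbAfter N G p * β ^ (k (candidateIndex p) - departures (ex K) p) := by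
  simp [stayBound, h, hK]

/-- Outside the current candidate, either no candidate arises and the counter is unchanged, or a new
one is born with no departures. The budget `c i` then pays for `β ^ k (i + 1)` and for the rest `c
(i + 1)`. -/
theorem falseBound_concat_le [Finite V] (hG : IsClosedSet N G)
    (hc : ∀ i, β ^ k (i + 1) + c (i + 1) ≤ c i) (p : List V) (y : V)
    (h : ¬ ∃ K, candidate p = some K ∧ y ∈ K) :
    falseBound N G β k ex c (p ++ [y]) ≤ absorb N G y * c (candidateIndex p) := by
  rw [falseBound, absorbAfter_concat hG]
  cases hK : candidate (p ++ [y]) with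
  | none => simp [stayBound, hK, candidateIndex_concat_of_none hK]
  | some K =>
    have hy : y ∈ K := (candidate_eq_some_iff.1 hK).last_mem y (by simp)
    have hne : candidate p ≠ some K := fun h' => h ⟨K, h', hy⟩
    rw [candidateIndex_concat_of_ne hK hne]
    refine le_trans ?_ (mul_le_mul_right (hc (candidateIndex p)) _)
    rw [mul_add, add_comm]
    refine add_le_add_left ?_ _
    by_cases hcl : IsClosedSet N K
    · rw [stayBound_of_closed hK hcl]
      exact bot_le
    · rw [stayBound_of_not_closed hK hcl, absorbAfter_concat hG, candidateIndex_concat_of_ne hK hne,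
        departures_concat_of_ne hK hne, Nat.sub_zero]

-- Leaving a candidate that is not closed forfeits its stay term, and staying keeps it. At the exit
-- state the weight remaining in the candidate shrinks by `1 - δ`, which pays for the departure just
-- counted. With no candidate or a closed one there is no stay term to preserve.
open Classical in
theorem mean_falseBound_le [Finite V] (hG : IsClosedSet N G)
    {δ : ℝ≥0∞} (hδ : ∀ x y, Edge N x y → δ ≤ N.trans x y)
    (hex : ∀ K : Set V, K.Nonempty → (∀ x ∈ K, ∀ y ∈ K, ReflTransGen (Edge N) x y) →
      ¬ IsClosedSet N K →
      ex K ∈ K ∧ ∃ y, y ∉ K ∧ Edge N (ex K) y ∧ absorb N G (ex K) ≤ absorb N G y)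
    (hc : ∀ i, (1 - δ) ^ k (i + 1) + c (i + 1) ≤ c i) (p : List V) (hp : IsPath N p) :
    mean (nextState N p) (fun y => falseBound N G (1 - δ) k ex c (p ++ [y])) ≤
      falseBound N G (1 - δ) k ex c p := by
  by_cases hA : ∃ K, candidate p = some K ∧ ¬ IsClosedSet N K
  · obtain ⟨K, hK, hcl⟩ := hA
    have hbot := candidate_eq_some_iff.1 hK
    obtain ⟨x, hx⟩ : ∃ x, p.getLast? = some x :=
      ⟨p.getLast hbot.nonempty, List.getLast?_eq_some_getLast _⟩
    have hxK := hbot.last_mem x hx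
    obtain ⟨hexK, z, hzK, hz, hzle⟩ := hex K ⟨x, hxK⟩ (hp.candidate_connected hK) hcl
    set d' := departures (ex K) p + if p.getLast? = some (ex K) then 1 else 0 with hd'
    have h1 : mean (nextState N p) (fun y => falseBound N G (1 - δ) k ex c (p ++ [y])) ≤
        absorbAfter N G p * c (candidateIndex p) +
        mean (nextState N p) (fun y => if y ∈ K then absorb N G y else 0) *
          (1 - δ) ^ (k (candidateIndex p) - d') := by
      rw [absorbAfter, ← mean_mul_right, ← mean_mul_right, ← mean_add]
      refine mean_mono fun y _ => ?_
      split_ifs with hy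
      · rw [falseBound, stayBound_of_not_closed (candidate_concat_of_mem hK hy) hcl,
          absorbAfter_concat hG, candidateIndex_concat_of_mem hK hy,
          departures_concat_of_mem hK hy]
      · rw [zero_mul, add_zero]
        refine falseBound_concat_le hG hc p y ?_
        rintro ⟨K', hK', hy'⟩
        rw [hK] at hK'
        exact hy (Option.some.inj hK' ▸ hy')
    refine h1.trans ?_
    rw [falseBound, stayBound_of_not_closed hK hcl]
    refine add_le_add_right ?_ _
    by_cases hxe : p.getLast? = some (ex K)
    -- The exit transition to `z` has probability at least `δ` and does not decrease `absorb`, so at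
    -- least the share `δ` of the weight leaves `K`.
    · have hmass : mean (nextState N p) (fun y => if y ∈ K then absorb N G y else 0) ≤
          absorbAfter N G p * (1 - δ) := by
        rw [absorbAfter_of_getLast? hG hxe, nextState_of_getLast? hxe, ENNReal.mul_sub
          (fun _ _ => absorb_ne_top G _), mul_one]
        refine ENNReal.le_sub_of_add_le_right ?_ ?_
        · exact ENNReal.mul_ne_top (absorb_ne_top G _)
            (ne_top_of_le_ne_top ((N.trans _).apply_ne_top z) (hδ _ z hz))
        · calc mean (N.trans (ex K)) (fun y => if y ∈ K then absorb N G y else 0) +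
                absorb N G (ex K) * δ
              ≤ mean (N.trans (ex K)) (fun y => if y ∈ K then absorb N G y else 0) +
                mean (N.trans (ex K)) (fun y => if y ∈ K then 0 else absorb N G y) := by
                refine add_le_add_right ?_ _
                refine le_trans ?_ (mul_le_mean _ _ z)
                rw [if_neg hzK, mul_comm]
                exact mul_le_mul' (hδ _ z hz) hzle
            _ = absorb N G (ex K) := by
                rw [← mean_add, ← mean_absorb hG (ex K)]
                refine mean_congr fun y _ => ?_
                split_ifs <;> simp
      refine (mul_le_mul_left hmass _).trans ?_
      rw [mul_assoc]
      refine mul_le_mul_right ?_ _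
      rw [← pow_succ', hd', if_pos hxe]
      -- Only an inequality, because the exponents are truncated differences.
      exact pow_le_pow_right_of_le_one' tsub_le_self (by omega)
    · rw [hd', if_neg hxe, add_zero]
      refine mul_le_mul_left (mean_mono fun y _ => ?_) _
      split_ifs
      · exact le_rfl
      · exact bot_le
  · refine le_trans (mean_mono (g := fun y => absorb N G y * c (candidateIndex p)) fun y hy => ?_) ?_
    · by_cases hB : ∃ K, candidate p = some K ∧ y ∈ K
      · obtain ⟨K, hK, hyK⟩ := hB
        have hcl : IsClosedSet N K := by
          by_contra hcl
          exact hA ⟨K, hK, hcl⟩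
        rw [falseBound, stayBound_of_closed (candidate_concat_of_mem hK hyK) hcl,
          absorbAfter_concat hG, candidateIndex_concat_of_mem hK hyK, add_zero]
      · exact falseBound_concat_le hG hc p y hB
    · rw [mean_mul_right, falseBound]
      exact le_self_add

/-- If every path in `T` has a candidate whose strength has reached the threshold `k i`, and that
excludes reaching `G` if it is closed, then the chain avoids `T` with a large probability. -/
theorem hitProb_nil_add_le [Finite V] {T : Set (List V)} (hG : IsClosedSet N G)
    {δ : ℝ≥0∞} (hδ : ∀ x y, Edge N x y → δ ≤ N.trans x y)
    (hc : ∀ i, (1 - δ) ^ k (i + 1) + c (i + 1) ≤ c i)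
    (hT : ∀ p ∈ T, IsPath N p → ∃ K, candidate p = some K ∧ k (candidateIndex p) ≤ strength p ∧
      (IsClosedSet N K → ∀ x ∈ K, absorb N G x = 0)) :
    hitProb N T [] + absorbAfter N G [] ≤ 1 + absorbAfter N G [] * c 0 := by
  classical
  have hex : ∀ K : Set V, ∃ x, K.Nonempty → (∀ x ∈ K, ∀ y ∈ K, ReflTransGen (Edge N) x y) →
      ¬ IsClosedSet N K → x ∈ K ∧ ∃ y, y ∉ K ∧ Edge N x y ∧ absorb N G x ≤ absorb N G y := by
    intro K
    by_cases h : K.Nonempty ∧ (∀ x ∈ K, ∀ y ∈ K, ReflTransGen (Edge N) x y) ∧ ¬ IsClosedSet N K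
    · obtain ⟨x, hx, y, hy⟩ := exists_exit hG h.1 h.2.1 h.2.2
      exact ⟨x, fun _ _ _ => ⟨hx, y, hy⟩⟩
    · obtain ⟨x, -⟩ := N.init.support_nonempty
      exact ⟨x, fun h1 h2 h3 => absurd ⟨h1, h2, h3⟩ h⟩
  choose ex hex using hex
  have h := hitProb_add_le (N := N) (T := T) (IsPath N)
    (fun p y hp hy _ => isPath_concat_iff.2 ⟨hp, hy⟩) (absorbAfter N G)
    (falseBound N G (1 - δ) k ex c) absorbAfter_le_one
    (fun p _ => ?_) (fun p hp _ => mean_falseBound_le hG hδ hex hc p hp) (fun p hp hpT => ?_)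
    [] isPath_nil
  · simpa [falseBound, stayBound, candidateIndex_nil] using h
  · simp only [absorbAfter_concat hG]
    exact le_rfl
  · obtain ⟨K, hK, hk, hcl⟩ := hT p hpT hp
    have hbot := candidate_eq_some_iff.1 hK
    obtain ⟨x, hx⟩ : ∃ x, p.getLast? = some x :=
      ⟨p.getLast hbot.nonempty, List.getLast?_eq_some_getLast _⟩
    have hxK := hbot.last_mem x hx
    -- On a closed candidate reaching `G` is impossible. Otherwise the departures from the exit
    -- state have met the threshold, so the stay term is all of `absorbAfter N G p`.
    by_cases hclK : IsClosedSet N K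
    · rw [absorbAfter_of_getLast? hG hx, hcl hclK x hxK]
      exact bot_le
    · rw [falseBound, stayBound_of_not_closed hK hclK]
      have hexK := (hex K ⟨x, hxK⟩ (hp.candidate_connected hK) hclK).1
      rw [Nat.sub_eq_zero_of_le (hk.trans (strength_le_departures hK hexK)), pow_zero, mul_one]
      exact le_add_self

end FalseCandidates

/-! ## The threshold -/

/-- In base-2 logarithms: `a ≥ -1 / log (1 - pm)` gives `a * log (1 - pm) ≤ -1`, so the exponent is
at most `-(i - log ε)`. -/
theorem pow_ceil_le {pm ε a : ℝ} (hpm : 0 < pm) (hpm1 : pm ≤ 1) (hε : 0 < ε) (hε1 : ε < 1)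
    (ha : max 1 (-1 / Real.logb 2 (1 - pm)) ≤ a) (i : ℕ) :
    (1 - pm) ^ ⌈a * ((i : ℝ) - Real.logb 2 ε)⌉₊ ≤ ε * (1 / 2) ^ i := by
  have hlogε : Real.logb 2 ε < 0 := Real.logb_neg (by norm_num) hε hε1
  have hpos : 0 < (i : ℝ) - Real.logb 2 ε := by
    have : (0 : ℝ) ≤ i := i.cast_nonneg
    linarith
  have ha1 : 1 ≤ a := (le_max_left _ _).trans ha
  have hk := Nat.le_ceil (a * ((i : ℝ) - Real.logb 2 ε))
  have hk0 : 0 < ⌈a * ((i : ℝ) - Real.logb 2 ε)⌉₊ := Nat.ceil_pos.2 (by positivity)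
  -- For `pm = 1` the logarithm takes its default value, but the base is zero and the exponent
  -- positive, thanks to `a ≥ 1`.
  rcases hpm1.eq_or_lt with rfl | hlt
  · rw [sub_self, zero_pow hk0.ne']
    positivity
  · set b := 1 - pm with hb
    have hb0 : 0 < b := by linarith
    have hlogb : Real.logb 2 b < 0 := Real.logb_neg (by norm_num) hb0 (by linarith)
    have ha2 : -1 / Real.logb 2 b ≤ a := (le_max_right _ _).trans ha
    set k := ⌈a * ((i : ℝ) - Real.logb 2 ε)⌉₊ with hkdef
    have h1 : (k : ℝ) * Real.logb 2 b ≤ -((i : ℝ) - Real.logb 2 ε) := by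
      have h2 : a * Real.logb 2 b ≤ -1 := by
        rw [div_le_iff_of_neg hlogb] at ha2
        exact ha2
      have h3 : (k : ℝ) * Real.logb 2 b ≤ (a * ((i : ℝ) - Real.logb 2 ε)) * Real.logb 2 b :=
        mul_le_mul_of_nonpos_right hk hlogb.le
      nlinarith [h2, h3, hpos]
    have h4 : b ^ k = (2 : ℝ) ^ ((k : ℝ) * Real.logb 2 b) := by
      rw [mul_comm, Real.rpow_mul (by norm_num), Real.rpow_logb (by norm_num) (by norm_num) hb0,
        Real.rpow_natCast]
    have h5 : ε * (1 / 2) ^ i = (2 : ℝ) ^ (-((i : ℝ) - Real.logb 2 ε)) := by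
      rw [neg_sub, Real.rpow_sub (by norm_num), Real.rpow_logb (by norm_num) (by norm_num) hε,
        Real.rpow_natCast, one_div, inv_pow, div_eq_mul_inv]
    rw [h4, h5]
    exact Real.rpow_le_rpow_of_exponent_le (by norm_num) h1

/-- The budget `ε / 2 ^ i` halves at each candidate: one half covers candidate `i + 1`, the other
all later ones. -/
theorem pow_ceil_add_le {pm ε a : ℝ} (hpm : 0 < pm) (hpm1 : pm ≤ 1) (hε : 0 < ε) (hε1 : ε < 1)
    (ha : max 1 (-1 / Real.logb 2 (1 - pm)) ≤ a) (i : ℕ) :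
    (1 - ENNReal.ofReal pm) ^ ⌈a * (((i + 1 : ℕ) : ℝ) - Real.logb 2 ε)⌉₊ +
      ENNReal.ofReal (ε * (1 / 2) ^ (i + 1)) ≤ ENNReal.ofReal (ε * (1 / 2) ^ i) := by
  have h := pow_ceil_le hpm hpm1 hε hε1 ha (i + 1)
  rw [show ε * (1 / 2) ^ i = ε * (1 / 2) ^ (i + 1) + ε * (1 / 2) ^ (i + 1) by ring,
    ENNReal.ofReal_add (by positivity) (by positivity), ← ENNReal.ofReal_one,
    ← ENNReal.ofReal_sub _ hpm.le, ← ENNReal.ofReal_pow (by linarith)]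
  exact add_le_add_left (ENNReal.ofReal_le_ofReal h) _

end BoldMonitor

namespace BoldMonitor

open Relation

/-! ## Infinite paths -/

section InfinitePaths

variable {V : Type*}

/-- The states that an infinite path visits infinitely often. -/
def infSet (w : ℕ → V) : Set V := {v | ∃ᶠ n in atTop, w n = v}

theorem eventually_mem_infSet [Finite V] (w : ℕ → V) : ∀ᶠ n in atTop, w n ∈ infSet w := by
  have h : ∀ v, ∀ᶠ n in atTop, v ∉ infSet w → w n ≠ v := by
    intro v
    by_cases hv : v ∈ infSet w
    · simp [hv]
    · have : ∀ᶠ n in atTop, ¬ w n = v := not_frequently.1 hv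
      filter_upwards [this] with n hn _ using hn
  filter_upwards [eventually_all.2 h] with n hn
  by_contra h'
  exact hn (w n) h' rfl

theorem mem_drop_runPrefix (w : ℕ → V) {b j n : ℕ} (hb : b ≤ j) (hj : j < n) :
    w j ∈ (runPrefix w n).drop b := by
  rw [List.mem_iff_getElem]
  refine ⟨j - b, by simp; omega, ?_⟩
  simp only [List.getElem_drop, runPrefix, List.getElem_map, List.getElem_range]
  congr 1
  omega

theorem mem_runPrefix (w : ℕ → V) {j n : ℕ} (hj : j < n) : w j ∈ runPrefix w n := by
  simpa using mem_drop_runPrefix w (Nat.zero_le j) hj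

theorem getLast?_runPrefix_succ (w : ℕ → V) (n : ℕ) :
    (runPrefix w (n + 1)).getLast? = some (w n) := by
  simp [runPrefix_succ]

variable {N : MarkovChain V} {w : ℕ → V}

theorem reflTransGen_of_edges (hw : ∀ n, Edge N (w n) (w (n + 1))) {m n : ℕ} (h : m ≤ n) :
    ReflTransGen (Edge N) (w m) (w n) := by
  induction n, h using Nat.le_induction with
  | base => exact ReflTransGen.refl
  | succ n _ ih => exact ih.tail (hw n)

theorem isPath_runPrefix (h0 : N.init (w 0) ≠ 0) (hw : ∀ n, Edge N (w n) (w (n + 1))) (n : ℕ) :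
    IsPath N (runPrefix w n) := by
  induction n with
  | zero => exact isPath_nil
  | succ n ih =>
    rw [runPrefix_succ, isPath_concat_iff]
    refine ⟨ih, ?_⟩
    cases n with
    | zero => exact h0
    | succ n =>
      rw [nextState_of_getLast? (getLast?_runPrefix_succ w n)]
      exact hw n

open Classical in
theorem eventually_le_count {v : V} (hv : v ∈ infSet w) (b m : ℕ) :
    ∀ᶠ n in atTop, m ≤ ((runPrefix w n).drop b).count v := by
  have hmono : Monotone fun n => ((runPrefix w n).drop b).count v := by
    refine monotone_nat_of_le_succ fun n => List.Sublist.count_le v ?_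
    rw [runPrefix_succ]
    exact (List.sublist_append_left _ _).drop b
  suffices h : ∃ n, m ≤ ((runPrefix w n).drop b).count v by
    obtain ⟨n, hn⟩ := h
    filter_upwards [eventually_ge_atTop n] with n' hn' using hn.trans (hmono hn')
  induction m with
  | zero => exact ⟨0, Nat.zero_le _⟩
  | succ m ih =>
    obtain ⟨n, hn⟩ := ih
    obtain ⟨k, hk, hkv⟩ := (frequently_atTop.1 hv) (max n b)
    refine ⟨k + 1, ?_⟩
    have h1 := hmono (show n ≤ k by omega)
    simp only at h1
    rw [runPrefix_succ, List.drop_append_of_le_length (by rw [length_runPrefix]; omega),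
      List.count_append, hkv]
    simp
    omega

variable [Finite V]

theorem isClosedClass_infSet (hw : ∀ n, Edge N (w n) (w (n + 1)))
    (hcl : ∀ x y, Edge N x y → (∃ᶠ n in atTop, w n = x) → ∃ᶠ n in atTop, w n = y) :
    IsClosedClass N (infSet w) := by
  refine ⟨?_, fun x hx y hxy => hcl x y hxy hx, fun x hx y hy => ?_⟩
  · obtain ⟨n, hn⟩ := (eventually_mem_infSet w).exists
    exact ⟨_, hn⟩
  · obtain ⟨m, rfl⟩ := Frequently.exists hx
    obtain ⟨n, hmn, rfl⟩ := (frequently_atTop.1 hy) m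
    exact reflTransGen_of_edges hw hmn

theorem exists_time_visited (w : ℕ → V) (m : ℕ) :
    ∃ n, ∀ v ∈ infSet w, ∃ i, m ≤ i ∧ i < n ∧ w i = v := by
  have h : ∀ v, ∃ i, v ∈ infSet w → m ≤ i ∧ w i = v := by
    intro v
    by_cases hv : v ∈ infSet w
    · obtain ⟨i, hi⟩ := (frequently_atTop.1 hv) m
      exact ⟨i, fun _ => hi⟩
    · exact ⟨0, fun h => absurd h hv⟩
  choose i hi using h
  obtain ⟨n, hn⟩ := Set.finite_range i |>.bddAbove
  refine ⟨n + 1, fun v hv => ⟨i v, (hi v hv).1, ?_, (hi v hv).2⟩⟩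
  exact Nat.lt_succ_of_le (hn ⟨v, rfl⟩)

/-- If the recurrent states of an infinite path form a closed class, this class is eventually the
candidate. -/
theorem exists_candidate_eq_infSet (h0 : N.init (w 0) ≠ 0) (hw : ∀ n, Edge N (w n) (w (n + 1)))
    (hcl : IsClosedSet N (infSet w)) :
    ∃ n₀, ∀ n ≥ n₀, candidate (runPrefix w n) = some (infSet w) := by
  -- After `n₁` the path stays among its recurrent states. Two full sweeps, before `n₂` and between
  -- `n₂` and `n₃`, ensure that each of these states has reached each other one.
  obtain ⟨n₁, hn₁⟩ := eventually_atTop.1 (eventually_mem_infSet w)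
  obtain ⟨n₂, hn₂⟩ := exists_time_visited w 0
  obtain ⟨n₃, hn₃⟩ := exists_time_visited w n₂
  refine ⟨n₁ + n₂ + n₃ + 1, fun n hn => candidate_eq_some_iff.2 ⟨?_, ?_, ?_, ?_⟩⟩
  · intro x hx
    obtain ⟨m, rfl⟩ : ∃ m, n = m + 1 := ⟨n - 1, by omega⟩
    rw [getLast?_runPrefix_succ] at hx
    rw [← Option.some.inj hx]
    exact hn₁ m (by omega)
  · intro h
    have := congrArg List.length h
    simp at this
    omega
  · exact fun v u hv h => hcl v hv u ((isPath_runPrefix h0 hw n).edge_of_adj h)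
  · intro v hv u hu
    obtain ⟨i, -, hi, rfl⟩ := hn₂ v hv
    obtain ⟨j, hj, hj', rfl⟩ := hn₃ u hu
    have h1 : w i ∈ (runPrefix w n).take n₂ := by
      rw [take_runPrefix w (by omega)]
      exact mem_runPrefix w hi
    have h2 : w j ∈ (runPrefix w n).drop n₂ := mem_drop_runPrefix w hj (by omega)
    have := transGen_pathGraph_append _ _ h1 h2
    rwa [List.take_append_drop] at this

/-- Along such a path the candidate counter is eventually constant, and the strength is
unbounded. -/
theorem exists_le_strength (h0 : N.init (w 0) ≠ 0) (hw : ∀ n, Edge N (w n) (w (n + 1)))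
    (hcl : IsClosedSet N (infSet w)) (a : ℕ → ℝ) :
    ∃ n, candidate (runPrefix w n) = some (infSet w) ∧
      a (candidateIndex (runPrefix w n)) ≤ strength (runPrefix w n) := by
  classical
  obtain ⟨n₀, hn₀⟩ := exists_candidate_eq_infSet h0 hw hcl
  have hi : ∀ n ≥ n₀, candidateIndex (runPrefix w n) = candidateIndex (runPrefix w n₀) := by
    intro n hn
    induction n, hn using Nat.le_induction with
    | base => rfl
    | succ n hn ih =>
      rw [← ih, runPrefix_succ]
      refine candidateIndex_concat_of_mem (hn₀ n hn) ?_
      exact (candidate_eq_some_iff.1 (hn₀ (n + 1) (by omega))).last_mem _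
        (getLast?_runPrefix_succ w n)
  obtain ⟨m, hm⟩ := exists_nat_ge (a (candidateIndex (runPrefix w n₀)))
  have h : ∀ v, ∀ᶠ n in atTop, v ∈ infSet w → m + 1 ≤ ((runPrefix w n).drop n₀).count v := by
    intro v
    by_cases hv : v ∈ infSet w
    · filter_upwards [eventually_le_count hv n₀ (m + 1)] with n hn _ using hn
    · simp [hv]
  obtain ⟨n, hn, hn'⟩ := ((eventually_all.2 h).and (eventually_ge_atTop (n₀ + 1))).exists
  refine ⟨n, hn₀ n (by omega), ?_⟩
  rw [hi n (by omega)]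
  refine hm.trans (Nat.cast_le.2 (le_strength (hn₀ n (by omega)) (b := n₀) ?_ hn))
  -- The index `n₀` in `birth` stands for a prefix of length `n₀ + 1`; hence `n ≥ n₀ + 1` above.
  refine Nat.sInf_le ⟨by rw [length_runPrefix]; omega, ?_⟩
  rw [take_runPrefix w (by omega), hn₀ n (by omega), hn₀ (n₀ + 1) (by omega)]

end InfinitePaths

/-! ## The product chain -/

section Product

variable {S Q Ap : Type*} {M : LabelledMarkovChain S Ap} {A : DRA Q Ap}

/-- The second components of an infinite path of the product are the states of the automaton. -/
theorem snd_eq_stateAt {w : ℕ → S × Q} (h0 : (product M A).init (w 0) ≠ 0)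
    (hw : ∀ n, Edge (product M A) (w n) (w (n + 1))) (n : ℕ) :
    (w n).2 = A.stateAt (fun n => M.label (w n).1) (n + 1) := by
  induction n with
  | zero =>
    rw [product_init_apply] at h0
    split_ifs at h0 with h
    · exact h.symm
    · exact absurd rfl h0
  | succ n ih =>
    have h := hw n
    rw [Edge, product_trans_apply] at h
    split_ifs at h with h'
    · rw [h', ih]
      rfl
    · exact absurd rfl h

/-- By finiteness, recurrence of a set of states means recurrence of one of its elements. The
product is one letter ahead of the automaton, which does not affect limit behaviour. -/
theorem accepts_iff_goodSet_infSet [Finite S] [Finite Q] {w : ℕ → S × Q}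
    (hw : ∀ n, (w n).2 = A.stateAt (fun n => M.label (w n).1) (n + 1)) :
    A.Accepts (fun n => M.label (w n).1) ↔ A.GoodSet (infSet w) := by
  have hev := eventually_mem_infSet w
  constructor
  · rintro ⟨⟨E, F⟩, hEF, hE, hF⟩
    refine ⟨(E, F), hEF, fun x hx hxE => ?_, ?_⟩
    · obtain ⟨n₀, hn₀⟩ := eventually_atTop.1 hE
      obtain ⟨n, hn, rfl⟩ := (frequently_atTop.1 hx) n₀
      exact hn₀ (n + 1) (by omega) (hw n ▸ hxE)
    · obtain ⟨n₀, hn₀⟩ := eventually_atTop.1 hev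
      obtain ⟨n, hn, hnF⟩ := (frequently_atTop.1 hF) (n₀ + 1)
      obtain ⟨m, rfl⟩ : ∃ m, n = m + 1 := ⟨n - 1, by omega⟩
      refine ⟨w m, hn₀ m (by omega), ?_⟩
      rw [hw m]
      exact hnF
  · rintro ⟨⟨E, F⟩, hEF, hE, x, hx, hxF⟩
    refine ⟨(E, F), hEF, ?_, ?_⟩
    · obtain ⟨n₀, hn₀⟩ := eventually_atTop.1 hev
      refine eventually_atTop.2 ⟨n₀ + 1, fun n hn => ?_⟩
      obtain ⟨m, rfl⟩ : ∃ m, n = m + 1 := ⟨n - 1, by omega⟩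
      rw [← hw m]
      exact hE _ (hn₀ m (by omega))
    · refine frequently_atTop.2 fun n₀ => ?_
      obtain ⟨n, hn, rfl⟩ := (frequently_atTop.1 hx) n₀
      refine ⟨n + 1, by omega, ?_⟩
      rw [← hw n]
      exact hxF

/-- The union of the good closed classes of the product. -/
def goodStates (M : LabelledMarkovChain S Ap) (A : DRA Q Ap) : Set (S × Q) :=
  {x | ∃ K, IsClosedClass (product M A) K ∧ A.GoodSet K ∧ x ∈ K}

theorem isClosedSet_goodStates : IsClosedSet (product M A) (goodStates M A) :=
  fun _ ⟨K, hK, hg, hx⟩ y hxy => ⟨K, hK, hg, hK.closed _ hx y hxy⟩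

/-- Two closed classes that meet coincide, so a bad one is disjoint from all good ones and is never
left. -/
theorem absorb_eq_zero_of_bad {K : Set (S × Q)} (hK : IsClosedClass (product M A) K)
    (hbad : ¬ A.GoodSet K) {x : S × Q} (hx : x ∈ K) :
    absorb (product M A) (goodStates M A) x = 0 := by
  refine absorb_eq_zero hK.closed ?_ hx
  rintro y hy ⟨K', hK', hg, hy'⟩
  exact hbad (hK.eq_of_mem hK' hy hy' ▸ hg)

/-- The state of the automaton after reading the labels of a finite path. -/
def runState (M : LabelledMarkovChain S Ap) (A : DRA Q Ap) (l : List S) : Q :=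
  l.foldl (fun q s => A.step q (M.label s)) A.start

theorem runState_concat (l : List S) (s : S) :
    runState M A (l ++ [s]) = A.step (runState M A l) (M.label s) := by
  simp [runState]

theorem runState_runPrefix (s : ℕ → S) (n : ℕ) :
    runState M A (runPrefix s n) = A.stateAt (fun n => M.label (s n)) n := by
  induction n with
  | zero => rfl
  | succ n ih => rw [runPrefix_succ, runState_concat, ih, DRA.stateAt]

/-- The product path over an infinite path of the chain. -/
def liftPath (M : LabelledMarkovChain S Ap) (A : DRA Q Ap) (s : ℕ → S) (n : ℕ) : S × Q :=
  (s n, A.stateAt (fun n => M.label (s n)) (n + 1))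

theorem edge_liftPath {s : ℕ → S} (hs : ∀ n, M.trans (s n) (s (n + 1)) ≠ 0) (n : ℕ) :
    Edge (product M A) (liftPath M A s n) (liftPath M A s (n + 1)) := by
  rw [Edge, product_trans_apply, if_pos (show (liftPath M A s (n + 1)).2 =
    A.step (liftPath M A s n).2 (M.label (liftPath M A s (n + 1)).1) from rfl)]
  exact hs n

theorem ofReal_minProb_le {x y : S × Q} (h : Edge (product M A) x y) :
    ENNReal.ofReal M.minProb ≤ (product M A).trans x y := by
  rw [Edge] at h
  rw [product_trans_apply] at h ⊢
  split_ifs at h ⊢ with h'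
  · refine ENNReal.ofReal_le_of_le_toReal (csInf_le ⟨0, fun p hp => hp.1.le⟩ ?_)
    exact ⟨ENNReal.toReal_pos h ((M.trans x.1).apply_ne_top y.1), x.1, y.1, rfl⟩
  · exact absurd rfl h

variable [Finite S] [Finite Q]

/-- Almost surely the recurrent states of the product path form a closed class. -/
theorem ae_isClosedClass_liftPath : ∀ᵐ ρ ∂M.runMeasure,
    IsClosedClass (product M A) (infSet (liftPath M A ρ.states)) := by
  have h : ∀ z : (S × Q) × (S × Q), ∀ᵐ ρ ∂M.runMeasure, Edge (product M A) z.1 z.2 →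
      (∃ᶠ n in atTop, liftPath M A ρ.states n = z.1) →
      ∃ᶠ n in atTop, liftPath M A ρ.states n = z.2 := by
    rintro ⟨x, y⟩
    by_cases hxy : Edge (product M A) x y
    swap
    · simp [hxy]
    rw [Edge, product_trans_apply] at hxy
    split_ifs at hxy with hy
    swap
    · exact absurd rfl hxy
    -- The histories of `M` whose lift to the product ends in `x`; the product is thus handled on
    -- the run space of `M`.
    let C : (S × Q) → Set (List S) := fun x => {l | l.getLast? = some x.1 ∧ runState M A l = x.2}
    have hC : ∀ (ρ : ℕ → S) x n, runPrefix ρ (n + 1) ∈ C x ↔ liftPath M A ρ n = x := by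
      intro ρ x n
      change _ ∧ _ ↔ _
      rw [getLast?_runPrefix_succ, runState_runPrefix, liftPath, Prod.ext_iff, Option.some.injEq]
    have hfreq : ∀ (ρ : ℕ → S) x, (∃ᶠ n in atTop, runPrefix ρ n ∈ C x) ↔
        ∃ᶠ n in atTop, liftPath M A ρ n = x := by
      intro ρ x
      simp only [← hC]
      conv_lhs => rw [← map_add_atTop_eq_nat 1, frequently_map]
    filter_upwards [ae_frequently_of_frequently M.toMarkovChain (C x) (C y)
      (pos_iff_ne_zero.2 hxy) (by
        rintro l ⟨hl, hl'⟩
        rw [nextState_of_getLast? hl]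
        refine le_trans ?_ (mul_le_mean _ _ y.1)
        rw [if_pos, mul_one]
        exact ⟨by simp, by rw [runState_concat, hl', hy]⟩)] with ρ hρ _ hx
    exact (hfreq ρ.states y).1 (hρ ((hfreq ρ.states x).2 hx))
  filter_upwards [ae_all_iff.2 h, ae_nextState_ne_zero M.toMarkovChain] with ρ hρ hpos
  refine isClosedClass_infSet (edge_liftPath fun n => ?_) fun x y hxy => hρ (x, y) hxy
  have := hpos (n + 1)
  rwa [nextState_of_getLast? (getLast?_runPrefix_succ ρ.states n)] at this

/-- The absorption probability at the lifted current state is harmonic in the history. On almost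
every run satisfying φ the lift ends up in a good closed class, where this probability is 1. -/
theorem prob_le_absorbAfter {φ : LTL Ap} (hA : A.Recognizes φ) :
    M.prob φ ≤ absorbAfter (product M A) (goodStates M A) [] := by
  set G := goodStates M A with hG
  let f : List S → ℝ≥0∞ := fun l => match l.getLast? with
    | none => absorbAfter (product M A) G []
    | some s => absorb (product M A) G (s, runState M A l)
  have hf : ∀ l, mean (nextState M.toMarkovChain l) (fun y => f (l ++ [y])) ≤ f l := by
    intro l
    have h1 : ∀ y, f (l ++ [y]) = absorb (product M A) G (y, A.step (runState M A l) (M.label y)) := by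
      intro y
      simp [f, runState_concat]
    simp only [h1]
    cases hl : l.getLast? with
    | none =>
      rw [List.getLast?_eq_none_iff] at hl
      subst hl
      simp only [f, List.getLast?_nil, absorbAfter, nextState_nil, product, mean_map]
      exact le_rfl
    | some s =>
      rw [nextState_of_getLast? hl]
      simp only [f, hl]
      rw [← mean_absorb isClosedSet_goodStates]
      simp only [product, mean_map]
      exact le_rfl
  refine measure_le_of_eventually_le M.toMarkovChain f hf _ ?_
  filter_upwards [ae_isClosedClass_liftPath (M := M) (A := A)] with ρ hρ hsat
  have hgood : A.GoodSet (infSet (liftPath M A ρ.states)) :=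
    (accepts_iff_goodSet_infSet (M := M) (w := liftPath M A ρ.states) (fun n => rfl)).1
      ((hA _).2 hsat)
  obtain ⟨n₀, hn₀⟩ := eventually_atTop.1 (eventually_mem_infSet (liftPath M A ρ.states))
  filter_upwards [eventually_ge_atTop (n₀ + 1)] with n hn
  obtain ⟨m, rfl⟩ : ∃ m, n = m + 1 := ⟨n - 1, by omega⟩
  simp only [f, getLast?_runPrefix_succ, runState_runPrefix]
  exact (absorb_of_mem (show liftPath M A ρ.states m ∈ G from ⟨_, hρ, hgood, hn₀ m (by omega)⟩)).ge

/-! ### A single sample -/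

/-- The paths on which the monitor resets. -/
def exitSet (A : DRA Q Ap) (a : ℕ) (ε : ℝ) : Set (List (S × Q)) := {p | ExitCond A a ε p}

/-- The probability of a reset in a sample is bounded away from `1` uniformly in the parameter. -/
theorem exists_hitProb_exitSet_le {φ : LTL Ap} (hA : A.Recognizes φ) (hφ : 0 < M.prob φ) (ε : ℝ) :
    ∃ θ < 1, ∀ a, hitProb (product M A) (exitSet A a ε) [] ≤ θ := by
  -- Dropping the strength condition makes the bound independent of the parameter.
  refine ⟨hitProb (product M A) {p | A.Bad p} [], ?_, fun a => hitProb_mono (fun p hp => hp.1) _⟩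
  have h := (hφ.trans_le (prob_le_absorbAfter hA)).ne'
  obtain ⟨x, hx, hxa⟩ : ∃ x, (product M A).init x ≠ 0 ∧
      absorb (product M A) (goodStates M A) x ≠ 0 := by
    by_contra! h'
    exact h (le_antisymm (mean_le fun y hy => (h' y hy).le) bot_le)
  obtain ⟨y, ⟨B, hB, ⟨EF, hEF, hE, f, hfB, hfF⟩, hyB⟩, hxy⟩ :=
    exists_reachable_of_absorb_ne_zero hxa
  refine hitProb_nil_lt_one hB hfB ?_ hx (hxy.trans (hB.connected y hyB f hfB))
  rintro p ⟨K, hK, hbad⟩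
  exact ⟨K, hK, fun h => hbad ⟨EF, hEF, fun z hz => hE z (h.2 hz), f, h.1, hfF⟩⟩

theorem minProb_mem : M.minProb ∈ {p : ℝ | 0 < p ∧ ∃ x y, p = (M.trans x y).toReal} := by
  apply Set.Nonempty.csInf_mem
  · obtain ⟨x, -⟩ := M.init.support_nonempty
    obtain ⟨y, hy⟩ := (M.trans x).support_nonempty
    exact ⟨_, ENNReal.toReal_pos hy ((M.trans x).apply_ne_top y), x, y, rfl⟩
  · refine (Set.finite_range fun z : S × S => (M.trans z.1 z.2).toReal).subset ?_
    rintro p ⟨-, x, y, rfl⟩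
    exact ⟨(x, y), rfl⟩

theorem minProb_le_one : M.minProb ≤ 1 := by
  obtain ⟨-, x, y, h⟩ := minProb_mem (M := M)
  rw [h]
  exact ENNReal.toReal_le_of_le_ofReal zero_le_one (by simpa using (M.trans x).coe_le_one y)

/-- The probability of a reset in a sample with a sufficiently large parameter. -/
theorem hitProb_exitSet_le {φ : LTL Ap} (hA : A.Recognizes φ) {ε : ℝ} (hε : 0 < ε) (hε1 : ε < 1)
    {a : ℕ} (ha : M.alphaZero ≤ a) :
    hitProb (product M A) (exitSet A a ε) [] ≤ 1 - M.prob φ * ENNReal.ofReal (1 - ε) := by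
  have h := hitProb_nil_add_le (N := product M A) (G := goodStates M A) (T := exitSet A a ε)
    (k := fun i => ⌈(a : ℝ) * ((i : ℝ) - Real.logb 2 ε)⌉₊)
    (c := fun i => ENNReal.ofReal (ε * (1 / 2) ^ i)) isClosedSet_goodStates
    (fun x y hxy => ofReal_minProb_le hxy)
    (fun i => pow_ceil_add_le minProb_mem.1 minProb_le_one hε hε1 ha i) ?_
  · set H := absorbAfter (product M A) (goodStates M A) []
    have hH1 : H ≤ 1 := absorbAfter_le_one _
    have hle : M.prob φ ≤ H := prob_le_absorbAfter hA
    have hsplit : H = H * ENNReal.ofReal (1 - ε) + H * ENNReal.ofReal ε := by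
      rw [← mul_add, ← ENNReal.ofReal_add (by linarith) hε.le]
      simp
    simp only [pow_zero, mul_one] at h
    have h' : hitProb (product M A) (exitSet A a ε) [] + H * ENNReal.ofReal (1 - ε) +
        H * ENNReal.ofReal ε ≤ 1 + H * ENNReal.ofReal ε := by
      -- Splitting `H` as `H (1 - ε) + H ε` lets the finite term `H ε` cancel on both sides.
      rwa [add_assoc, ← hsplit]
    have hne : H * ENNReal.ofReal ε ≠ ∞ :=
      ENNReal.mul_ne_top (ne_top_of_le_ne_top ENNReal.one_ne_top hH1) ENNReal.ofReal_ne_top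
    have h'' := (ENNReal.add_le_add_iff_right hne).1 h'
    have hle' : M.prob φ * ENNReal.ofReal (1 - ε) ≤ H * ENNReal.ofReal (1 - ε) :=
      mul_le_mul_left hle _
    refine ENNReal.le_sub_of_add_le_right ?_ ((add_le_add_right hle' _).trans h'')
    exact ne_top_of_le_ne_top ENNReal.one_ne_top (hle'.trans ((le_add_self).trans h''))
  · rintro p ⟨⟨K, hK, hbad⟩, hstr⟩ hp
    refine ⟨K, hK, Nat.ceil_le.2 hstr, fun hcl x hx => ?_⟩
    exact absorb_eq_zero_of_bad ⟨⟨x, hx⟩, hcl, hp.candidate_connected hK⟩ hbad hx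

end Product

end BoldMonitor

namespace BoldMonitor

/-! ## The bold monitor -/

/-! ### Tail sums and products of reset probabilities -/

section Sums

open Classical in
theorem coe_enat_eq_tsum (x : ℕ∞) : (x : ℝ≥0∞) = ∑' m : ℕ, if (m : ℕ∞) < x then 1 else 0 := by
  induction x using ENat.recTopCoe with
  | top => simp
  | coe k =>
    rw [tsum_eq_sum (s := Finset.range k)]
    · rw [Finset.sum_congr rfl (g := fun _ => 1)]
      · simp
      · intro m hm
        simp [Finset.mem_range.1 hm]
    · intro m hm
      simpa using hm

theorem tsum_prod_le {u : ℕ → ℝ≥0∞} {θ : ℝ≥0∞} (hu : ∀ j, u j ≤ 1) (J : ℕ)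
    (hθ : ∀ j, J ≤ j → u j ≤ θ) :
    ∑' m : ℕ, ∏ j ∈ Finset.range (m + 1), u j ≤ J + (1 - θ)⁻¹ := by
  have hsplit := Summable.sum_add_tsum_nat_add' (k := J)
    (f := fun m => ∏ j ∈ Finset.range (m + 1), u j) ENNReal.summable
  rw [← hsplit]
  refine add_le_add ?_ ?_
  · refine (Finset.sum_le_sum fun m _ => Finset.prod_le_one' fun j _ => hu j).trans ?_
    simp
  · rw [← ENNReal.tsum_geometric]
    refine ENNReal.tsum_le_tsum fun m => ?_
    -- After the first `J` terms, term `m` keeps `m` of its factors with index at least `J`; the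
    -- others are bounded by 1.
    calc ∏ j ∈ Finset.range (m + J + 1), u j ≤ ∏ j ∈ Finset.Ico J (m + J), u j := by
          refine Finset.prod_le_prod_of_subset_of_le_one' ?_ fun j _ _ => hu j
          intro j hj
          rw [Finset.mem_Ico] at hj
          rw [Finset.mem_range]
          omega
      _ ≤ ∏ j ∈ Finset.Ico J (m + J), θ :=
          Finset.prod_le_prod' fun j hj => hθ j (Finset.mem_Ico.1 hj).1
      _ = θ ^ m := by simp

end Sums

/-! ### Resets and the last sample of the monitor's chain -/

section Bold

variable {S Q Ap : Type*} {M : LabelledMarkovChain S Ap} {A : DRA Q Ap} {α : ℕ → ℕ} {ε : ℝ}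

theorem boldChain_trans_of_exit {x : List (S × Q) × ℕ} (h : ExitCond A (α (x.2 + 1)) ε x.1) :
    (boldChain M A α ε).trans x = PMF.pure ([], x.2 + 1) := by
  simp [boldChain, h]

theorem boldChain_trans_of_not_exit {x : List (S × Q) × ℕ}
    (h : ¬ ExitCond A (α (x.2 + 1)) ε x.1) :
    (boldChain M A α ε).trans x =
      (nextState (product M A) x.1).map (fun y => (x.1 ++ [y], x.2)) := by
  simp [boldChain, h]

theorem boldChain_step {x y : List (S × Q) × ℕ} (h : (boldChain M A α ε).trans x y ≠ 0) :
    (ExitCond A (α (x.2 + 1)) ε x.1 ∧ y = ([], x.2 + 1)) ∨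
      (¬ ExitCond A (α (x.2 + 1)) ε x.1 ∧
        ∃ z, nextState (product M A) x.1 z ≠ 0 ∧ y = (x.1 ++ [z], x.2)) := by
  by_cases hx : ExitCond A (α (x.2 + 1)) ε x.1
  · rw [boldChain_trans_of_exit hx, ← PMF.mem_support_iff, PMF.mem_support_pure_iff] at h
    exact Or.inl ⟨hx, h⟩
  · rw [boldChain_trans_of_not_exit hx, ← PMF.mem_support_iff, PMF.mem_support_map_iff] at h
    obtain ⟨z, hz, rfl⟩ := h
    exact Or.inr ⟨hx, z, hz, rfl⟩

/-- The probability of a reset in a sample after `r` resets, from the current path on. -/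
noncomputable def resetProb (M : LabelledMarkovChain S Ap) (A : DRA Q Ap) (α : ℕ → ℕ) (ε : ℝ)
    (r : ℕ) : List (S × Q) → ℝ≥0∞ :=
  hitProb (product M A) (exitSet A (α (r + 1)) ε)

/-- The probability that the monitor, started in the given state, performs its `m`-th reset. -/
noncomputable def reachProb (M : LabelledMarkovChain S Ap) (A : DRA Q Ap) (α : ℕ → ℕ) (ε : ℝ)
    (m : ℕ) (x : List (S × Q) × ℕ) : ℝ≥0∞ :=
  if m ≤ x.2 then 1
  else resetProb M A α ε x.2 x.1 * ∏ j ∈ Finset.Ico (x.2 + 1) m, resetProb M A α ε j []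

theorem reachProb_le_one (m : ℕ) (x : List (S × Q) × ℕ) : reachProb M A α ε m x ≤ 1 := by
  unfold reachProb
  split_ifs
  · exact le_rfl
  · exact mul_le_one' (hitProb_le_one _ _) (Finset.prod_le_one' fun j _ => hitProb_le_one _ _)

theorem reachProb_nil (m r : ℕ) :
    reachProb M A α ε m ([], r) = ∏ j ∈ Finset.Ico r m, resetProb M A α ε j [] := by
  unfold reachProb
  split_ifs with h
  · rw [Finset.Ico_eq_empty_of_le h, Finset.prod_empty]
  · exact (Finset.prod_eq_prod_Ico_succ_bot (not_le.1 h) (fun j => resetProb M A α ε j [])).symm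

theorem boldChain_states {ρ : ℕ → List (S × Q) × ℕ}
    (hρ : ∀ n, nextState (boldChain M A α ε) (runPrefix ρ n) (ρ n) ≠ 0) :
    ρ 0 = ([], 0) ∧ ∀ n, (boldChain M A α ε).trans (ρ n) (ρ (n + 1)) ≠ 0 := by
  refine ⟨?_, fun n => ?_⟩
  · have h := hρ 0
    rw [runPrefix_zero, nextState_nil] at h
    change PMF.pure ([], 0) (ρ 0) ≠ 0 at h
    rwa [← PMF.mem_support_iff, PMF.mem_support_pure_iff] at h
  · have h := hρ (n + 1)
    rwa [nextState_of_getLast? (getLast?_runPrefix_succ ρ n)] at h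

theorem boldChain_resets_monotone {ρ : ℕ → List (S × Q) × ℕ}
    (hρ : ∀ n, (boldChain M A α ε).trans (ρ n) (ρ (n + 1)) ≠ 0) : Monotone fun n => (ρ n).2 := by
  refine monotone_nat_of_le_succ fun n => ?_
  rcases boldChain_step (hρ n) with ⟨-, h⟩ | ⟨-, z, -, h⟩
  · rw [h]
    exact Nat.le_succ _
  · rw [h]

theorem lt_resets_iff (ρ : Run (List (S × Q) × ℕ)) (m : ℕ) :
    (m : ℕ∞) < resets ρ ↔ ∃ n, m + 1 ≤ (ρ.states n).2 := by
  unfold resets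
  rw [lt_iSup_iff]
  exact exists_congr fun n => Nat.cast_lt

/-- A run with finitely many resets eventually executes an infinite path of the product. -/
theorem exists_last_sample {ρ : ℕ → List (S × Q) × ℕ} (h0 : ρ 0 = ([], 0))
    (hρ : ∀ n, (boldChain M A α ε).trans (ρ n) (ρ (n + 1)) ≠ 0) {b : ℕ} (hb : ∀ n, (ρ n).2 ≤ b) :
    ∃ (n₀ : ℕ) (w : ℕ → S × Q), (∀ n, (ρ n).2 ≤ (ρ n₀).2) ∧
      (∀ n, ρ (n₀ + n) = (runPrefix w n, (ρ n₀).2)) ∧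
      (∀ n, ¬ ExitCond A (α ((ρ n₀).2 + 1)) ε (runPrefix w n)) ∧
      (product M A).init (w 0) ≠ 0 ∧ ∀ n, Edge (product M A) (w n) (w (n + 1)) := by
  classical
  have hmono := boldChain_resets_monotone hρ
  have hmem : sSup (Set.range fun n => (ρ n).2) ∈ Set.range fun n => (ρ n).2 :=
    Nat.sSup_mem ⟨_, 0, rfl⟩ ⟨b, by rintro _ ⟨n, rfl⟩; exact hb n⟩
  have hex : ∃ n, ∀ k, (ρ k).2 ≤ (ρ n).2 := by
    obtain ⟨n, hn⟩ := hmem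
    refine ⟨n, fun k => ?_⟩
    simp only at hn
    rw [hn]
    exact le_csSup ⟨b, by rintro _ ⟨n, rfl⟩; exact hb n⟩ ⟨k, rfl⟩
  -- The first time with the maximal reset count is either the start or directly after a reset, so
  -- the current path is empty there; afterwards a further reset would exceed the maximum.
  set n₀ := Nat.find hex with hn₀
  have hmax : ∀ k, (ρ k).2 ≤ (ρ n₀).2 := Nat.find_spec hex
  have hnil : (ρ n₀).1 = [] := by
    rcases Nat.eq_zero_or_pos n₀ with h | h
    · rw [h, h0]
    · obtain ⟨m, hm⟩ : ∃ m, n₀ = m + 1 := ⟨n₀ - 1, by omega⟩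
      have hmin := Nat.find_min hex (m := m) (by omega)
      rcases boldChain_step (hρ m) with ⟨-, h⟩ | ⟨-, z, -, h⟩
      · rw [hm, h]
      · refine absurd (fun k => ?_) hmin
        have := hmax k
        rwa [hm, h] at this
  have hstep : ∀ n, ¬ ExitCond A (α ((ρ n₀).2 + 1)) ε (ρ (n₀ + n)).1 ∧ ∃ z,
      nextState (product M A) (ρ (n₀ + n)).1 z ≠ 0 ∧
      ρ (n₀ + (n + 1)) = ((ρ (n₀ + n)).1 ++ [z], (ρ n₀).2) := by
    intro n
    have h2 : (ρ (n₀ + n)).2 = (ρ n₀).2 := le_antisymm (hmax _) (hmono (Nat.le_add_right _ _))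
    rcases boldChain_step (hρ (n₀ + n)) with ⟨-, h⟩ | ⟨hne, z, hz, h⟩
    · have := hmax (n₀ + n + 1)
      rw [h, h2] at this
      simp at this
    · rw [h2] at hne h
      exact ⟨hne, z, hz, h⟩
  choose hne w hw hρw using hstep
  have hpre : ∀ n, ρ (n₀ + n) = (runPrefix w n, (ρ n₀).2) := by
    intro n
    induction n with
    | zero => exact Prod.ext hnil rfl
    | succ n ih => rw [hρw n, ih, runPrefix_succ]
  refine ⟨n₀, w, hmax, hpre, fun n => ?_, ?_, fun n => ?_⟩
  · have := hne n
    rwa [hpre n] at this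
  · have := hw 0
    rwa [hpre 0] at this
  · have := hw (n + 1)
    rwa [hpre (n + 1), nextState_of_getLast? (getLast?_runPrefix_succ w n)] at this

variable [Finite S] [Finite Q]

/-- At a reset the hitting probability is 1 and the next factor of the product takes over. Within a
sample this is the one-step equation for hitting probabilities. -/
theorem mean_reachProb_le (m : ℕ) (x : List (S × Q) × ℕ) :
    mean ((boldChain M A α ε).trans x) (reachProb M A α ε m) ≤ reachProb M A α ε m x := by
  by_cases hm : m ≤ x.2
  · rw [reachProb, if_pos hm]
    exact mean_le fun y _ => reachProb_le_one m y
  · by_cases hx : ExitCond A (α (x.2 + 1)) ε x.1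
    · rw [boldChain_trans_of_exit hx, mean_pure, reachProb_nil, reachProb, if_neg hm, resetProb,
        hitProb_of_mem (show x.1 ∈ exitSet A (α (x.2 + 1)) ε from hx), one_mul]
    · rw [boldChain_trans_of_not_exit hx, mean_map]
      simp only [reachProb, if_neg hm]
      rw [mean_mul_right]
      refine mul_le_mul_left ?_ _
      exact (hitProb_of_notMem (show x.1 ∉ exitSet A (α (x.2 + 1)) ε from hx)).ge

/-- The reset count never decreases, so the superharmonic function `reachProb` is eventually 1 once
`m` resets have occurred. -/
theorem measure_reach_le (m : ℕ) : (boldChain M A α ε).runMeasure {ρ | ∃ n, m ≤ (ρ.states n).2} ≤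
    ∏ j ∈ Finset.range m, resetProb M A α ε j [] := by
  let f : List (List (S × Q) × ℕ) → ℝ≥0∞ := fun l => match l.getLast? with
    | none => reachProb M A α ε m ([], 0)
    | some x => reachProb M A α ε m x
  have h0 : f [] = ∏ j ∈ Finset.range m, resetProb M A α ε j [] := by
    rw [Finset.range_eq_Ico, ← reachProb_nil]
    rfl
  rw [← h0]
  refine measure_le_of_eventually_le _ f (fun l => ?_) _ ?_
  · have h1 : ∀ y, f (l ++ [y]) = reachProb M A α ε m y := fun y => by simp [f]
    simp only [h1]
    cases hl : l.getLast? with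
    | none =>
      rw [List.getLast?_eq_none_iff] at hl
      subst hl
      rw [nextState_nil]
      exact (mean_pure ([], 0) (reachProb M A α ε m)).le
    | some x =>
      rw [nextState_of_getLast? hl]
      simp only [f, hl]
      exact mean_reachProb_le m x
  · filter_upwards [ae_nextState_ne_zero (boldChain M A α ε)] with ρ hρ
    rintro ⟨n₀, hn₀⟩
    have hmono := boldChain_resets_monotone (boldChain_states hρ).2
    filter_upwards [eventually_ge_atTop (n₀ + 1)] with n hn
    obtain ⟨k, rfl⟩ : ∃ k, n = k + 1 := ⟨n - 1, by omega⟩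
    simp only [f, getLast?_runPrefix_succ]
    rw [reachProb, if_pos (hn₀.trans (hmono (show n₀ ≤ k by omega)))]

theorem measure_lt_resets_le (m : ℕ) :
    (boldChain M A α ε).runMeasure {ρ | (m : ℕ∞) < resets ρ} ≤
      ∏ j ∈ Finset.range (m + 1), resetProb M A α ε j [] := by
  simp only [lt_resets_iff]
  exact measure_reach_le (m + 1)

theorem ae_resets_lt_top {φ : LTL Ap} (hA : A.Recognizes φ) (hφ : 0 < M.prob φ) :
    ∀ᵐ ρ ∂(boldChain M A α ε).runMeasure, resets ρ < ⊤ := by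
  obtain ⟨θ, hθ, hle⟩ := exists_hitProb_exitSet_le (M := M) hA hφ ε
  have h : ∀ m, (boldChain M A α ε).runMeasure {ρ | ¬ resets ρ < ⊤} ≤ θ ^ m := by
    intro m
    calc (boldChain M A α ε).runMeasure {ρ | ¬ resets ρ < ⊤}
        ≤ (boldChain M A α ε).runMeasure {ρ | ∃ n, m ≤ (ρ.states n).2} := by
          refine measure_mono fun ρ hρ => ?_
          have h' : (m : ℕ∞) < resets ρ := by
            rw [not_lt_top_iff.1 hρ]
            exact ENat.natCast_lt_top m
          obtain ⟨n, hn⟩ := (lt_resets_iff ρ m).1 h'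
          exact ⟨n, by omega⟩
      _ ≤ ∏ j ∈ Finset.range m, resetProb M A α ε j [] := measure_reach_le m
      _ ≤ ∏ j ∈ Finset.range m, θ := Finset.prod_le_prod' fun j _ => hle _
      _ = θ ^ m := by simp
  have hlim := ENNReal.tendsto_pow_atTop_nhds_zero_of_lt_one hθ
  exact le_antisymm (ge_of_tendsto' hlim h) bot_le

/-! ### The expected number of resets -/

theorem lintegral_resets_le :
    ∫⁻ ρ, (resets ρ : ℝ≥0∞) ∂(boldChain M A α ε).runMeasure ≤
      ∑' m : ℕ, ∏ j ∈ Finset.range (m + 1), resetProb M A α ε j [] := by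
  classical
  have hmeas : ∀ m : ℕ, MeasurableSet {ρ : Run (List (S × Q) × ℕ) | (m : ℕ∞) < resets ρ} := by
    intro m
    have : {ρ : Run (List (S × Q) × ℕ) | (m : ℕ∞) < resets ρ} =
        ⋃ n, {ρ | ρ.states n ∈ {x : List (S × Q) × ℕ | m + 1 ≤ x.2}} := by
      ext ρ
      simp only [Set.mem_ofPred_eq, lt_resets_iff, Set.mem_iUnion]
    rw [this]
    exact MeasurableSet.iUnion fun n => measurableSet_coord n _
  -- The expectation is the sum of the tail probabilities.
  simp only [coe_enat_eq_tsum]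
  rw [lintegral_tsum]
  · refine ENNReal.tsum_le_tsum fun m => le_trans (le_of_eq ?_) (measure_lt_resets_le m)
    rw [← lintegral_indicator_one (hmeas m)]
    refine lintegral_congr fun ρ => ?_
    simp [Set.indicator_apply]
  · exact fun m => (Measurable.ite (hmeas m) measurable_const measurable_const).aemeasurable

theorem lintegral_resets_le_of_alphaZero_le {φ : LTL Ap} (hA : A.Recognizes φ)
    (hα : MonotoneOn α (Set.Ici 1)) (hε : 0 < ε) (hε1 : ε < 1) {J : ℕ} (hJ1 : 1 ≤ J)
    (hJ : M.alphaZero ≤ (α J : ℝ)) :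
    ∫⁻ ρ, (resets ρ : ℝ≥0∞) ∂(boldChain M A α ε).runMeasure ≤
      (J : ℝ≥0∞) + 1 / (M.prob φ * ENNReal.ofReal (1 - ε)) := by
  have hq : M.prob φ * ENNReal.ofReal (1 - ε) ≤ 1 :=
    mul_le_one' ((prob_le_absorbAfter hA).trans (absorbAfter_le_one _))
      (ENNReal.ofReal_le_one.2 (by linarith))
  have h := tsum_prod_le (u := fun j => resetProb M A α ε j [])
    (θ := 1 - M.prob φ * ENNReal.ofReal (1 - ε)) (fun j => hitProb_le_one _ _) J (fun j hj => by
      refine hitProb_exitSet_le hA hε hε1 (hJ.trans ?_)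
      exact_mod_cast hα (Set.mem_Ici.2 hJ1) (Set.mem_Ici.2 (by omega)) (by omega))
  rw [ENNReal.sub_sub_cancel ENNReal.one_ne_top hq] at h
  rw [one_div]
  exact lintegral_resets_le.trans h

/-! ### The last sample -/

/-- Almost surely, if the current path of a sample ends with `x` infinitely often, then it also
ends infinitely often with every successor of `x`. -/
theorem ae_frequently_getLast {x y : S × Q} (hxy : Edge (product M A) x y) :
    ∀ᵐ ρ ∂(boldChain M A α ε).runMeasure,
      (∃ᶠ n in atTop, ¬ ExitCond A (α ((ρ.states n).2 + 1)) ε (ρ.states n).1 ∧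
        (ρ.states n).1.getLast? = some x) →
      ∃ᶠ n in atTop, (ρ.states n).1.getLast? = some y := by
  -- From a state without exit, ending in `x`, the monitor appends `y` with the product's transition
  -- probability, a fixed positive bound.
  let C : Set (List (List (S × Q) × ℕ)) := {l | ∃ s, l.getLast? = some s ∧
    ¬ ExitCond A (α (s.2 + 1)) ε s.1 ∧ s.1.getLast? = some x}
  let D : Set (List (List (S × Q) × ℕ)) := {l | ∃ s, l.getLast? = some s ∧ s.1.getLast? = some y}
  have h := ae_frequently_of_frequently (boldChain M A α ε) C D (pos_iff_ne_zero.2 hxy) (by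
    rintro l ⟨s, hl, hs, hx⟩
    rw [nextState_of_getLast? hl, boldChain_trans_of_not_exit hs, mean_map,
      nextState_of_getLast? hx]
    refine le_trans ?_ (mul_le_mean _ _ y)
    rw [if_pos, mul_one]
    exact ⟨(s.1 ++ [y], s.2), by simp, by simp⟩)
  filter_upwards [h] with ρ hρ hfreq
  have h1 : ∃ᶠ n in atTop, runPrefix ρ.states n ∈ C := by
    rw [frequently_atTop] at hfreq ⊢
    intro n₀
    obtain ⟨n, hn, hn'⟩ := hfreq n₀
    exact ⟨n + 1, by omega, ρ.states n, getLast?_runPrefix_succ _ _, hn'⟩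
  have h2 := hρ h1
  rw [frequently_atTop] at h2 ⊢
  intro n₀
  obtain ⟨n, hn, s, hs, hy⟩ := h2 (n₀ + 1)
  obtain ⟨m, rfl⟩ : ∃ m, n = m + 1 := ⟨n - 1, by omega⟩
  rw [getLast?_runPrefix_succ] at hs
  rw [← Option.some.inj hs] at hy
  exact ⟨m, by omega, hy⟩

/-- The path `w` of the last sample inherits recurrence along edges from the monitor's run, so its
recurrent states form a closed class. A bad class would eventually meet the exit condition, whatever
the parameter of that sample. -/
theorem ae_mem_satRuns {φ : LTL Ap} (hA : A.Recognizes φ) (hφ : 0 < M.prob φ) :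
    ∀ᵐ ρ ∂(boldChain M A α ε).runMeasure, ρ ∈ satRuns M φ := by
  have hcl : ∀ᵐ ρ ∂(boldChain M A α ε).runMeasure, ∀ z : (S × Q) × (S × Q),
      Edge (product M A) z.1 z.2 →
      (∃ᶠ n in atTop, ¬ ExitCond A (α ((ρ.states n).2 + 1)) ε (ρ.states n).1 ∧
        (ρ.states n).1.getLast? = some z.1) →
      ∃ᶠ n in atTop, (ρ.states n).1.getLast? = some z.2 := by
    refine ae_all_iff.2 fun z => ?_
    by_cases hz : Edge (product M A) z.1 z.2
    · filter_upwards [ae_frequently_getLast (α := α) (ε := ε) hz] with ρ hρ _ using hρ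
    · simp [hz]
  filter_upwards [ae_resets_lt_top (α := α) (ε := ε) hA hφ, hcl,
    ae_nextState_ne_zero (boldChain M A α ε)] with ρ hR hfreq hpos
  obtain ⟨h0, hstep⟩ := boldChain_states hpos
  obtain ⟨b, hb⟩ : ∃ b : ℕ, (b : ℕ∞) = resets ρ := ENat.ne_top_iff_exists.1 hR.ne
  obtain ⟨n₀, w, hmax, hpre, hne, hw0, hw⟩ := exists_last_sample h0 hstep (b := b) (fun n => by
    have : ((ρ.states n).2 : ℕ∞) ≤ resets ρ := le_iSup (fun n => ((ρ.states n).2 : ℕ∞)) n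
    rw [← hb] at this
    exact_mod_cast this)
  have hclass : IsClosedClass (product M A) (infSet w) := by
    refine isClosedClass_infSet hw fun x y hxy hx => ?_
    have h1 : ∃ᶠ n in atTop, ¬ ExitCond A (α ((ρ.states n).2 + 1)) ε (ρ.states n).1 ∧
        (ρ.states n).1.getLast? = some x := by
      rw [frequently_atTop] at hx ⊢
      intro m₀
      obtain ⟨m, hm, rfl⟩ := hx m₀
      refine ⟨n₀ + (m + 1), by omega, ?_⟩
      rw [hpre (m + 1)]
      exact ⟨hne (m + 1), getLast?_runPrefix_succ w m⟩
    have h2 := hfreq (x, y) hxy h1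
    rw [frequently_atTop] at h2 ⊢
    intro m₀
    obtain ⟨m, hm, hy⟩ := h2 (n₀ + (m₀ + 1))
    obtain ⟨k, rfl⟩ : ∃ k, m = n₀ + (k + 1) := ⟨m - n₀ - 1, by omega⟩
    rw [hpre (k + 1), getLast?_runPrefix_succ] at hy
    exact ⟨k, by omega, Option.some.inj hy⟩
  have hgood : A.GoodSet (infSet w) := by
    by_contra hbad
    obtain ⟨n, hn, hstr⟩ := exists_le_strength hw0 hw hclass.closed
      (fun i => (α ((ρ.states n₀).2 + 1) : ℝ) * ((i : ℝ) - Real.logb 2 ε))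
    exact hne n ⟨⟨_, hn, hbad⟩, hstr⟩
  refine ⟨hR, n₀, w, ?_, fun n => hpre n, ?_⟩
  · exact le_antisymm (le_iSup (fun n => ((ρ.states n).2 : ℕ∞)) n₀)
      (iSup_le fun n => Nat.cast_le.2 (hmax n))
  · exact (hA _).1 ((accepts_iff_goodSet_infSet (fun n => snd_eq_stateAt hw0 hw n)).2 hgood)

end Bold

end BoldMonitor

/-! ### The three claims combined -/

theorem mainTheorem3 {S Q Ap : Type*} [Finite S] [Finite Q] [Finite Ap]
    (M : BoldMonitor.LabelledMarkovChain S Ap) (φ : BoldMonitor.LTL Ap)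
    (A : BoldMonitor.DRA Q Ap) (hA : A.Recognizes φ) (hφ : 0 < M.prob φ)
    (α : ℕ → ℕ) (hα_mono : MonotoneOn α (Set.Ici 1)) (hα_one : α 1 = 1)
    (hα_lim : Tendsto α atTop atTop) (ε : ℝ) (hε : 0 < ε) :
    (∀ᵐ ρ ∂(BoldMonitor.boldChain M A α ε).runMeasure, BoldMonitor.resets ρ < ⊤) ∧
    ((∀ᵐ ρ ∂(BoldMonitor.boldChain M A α ε).runMeasure[|{ρ | BoldMonitor.resets ρ < ⊤}],
        ρ ∈ BoldMonitor.satRuns M φ) ∧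
      ∀ᵐ ρ ∂(BoldMonitor.boldChain M A α ε).runMeasure, ρ ∈ BoldMonitor.satRuns M φ) ∧
    (ε < 1 → ∀ jmin : ℕ, IsLeast {j | 1 ≤ j ∧ M.alphaZero ≤ (α j : ℝ)} jmin →
      ∫⁻ ρ, (BoldMonitor.resets ρ : ℝ≥0∞) ∂(BoldMonitor.boldChain M A α ε).runMeasure ≤
        (jmin : ℝ≥0∞) + 1 / (M.prob φ * ENNReal.ofReal (1 - ε))) := by
  have hsat := BoldMonitor.ae_mem_satRuns (α := α) (ε := ε) hA hφ
  refine ⟨BoldMonitor.ae_resets_lt_top hA hφ,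
    ⟨ProbabilityTheory.cond_absolutelyContinuous.ae_le hsat, hsat⟩, fun hε1 jmin hj => ?_⟩
  exact BoldMonitor.lintegral_resets_le_of_alphaZero_le hA hα_mono hε hε1 hj.1.1 hj.1.2
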